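/- For an integer $n\ge 1$ and reals $\rho,r,\varepsilon>0$, let $L_{n,\varepsilon}=\{(i\varepsilon,j\varepsilon): i,j\in\mathbb{N},\ i,j\le \sqrt n/\varepsilon\}$, let $d$ be the Euclidean distance, and for $x\in L_{n,\varepsilon}$ let $\Gamma(x)=\{y\in L_{n,\varepsilon}: d(x,y)\le\rho\}$. The stationary geometric-MEG $\mathcal{G}(n,\rho,r,\varepsilon)$ is the random sequence of graphs $(G_t)_{t\ge 0}$ on the nodes $1,\dots,n$ obtained as follows: the positions $(P_{i,t})_{t\ge 0}$, $i=1,\dots,n$, are independent Markov chains on $L_{n,\varepsilon}$, where $P_{i,t+1}$ is uniformly distributed on $\Gamma(P_{i,t})$ and $P_{i,0}$ has the stationary distribution $\pi(x)=|\Gamma(x)|/\sum_{y\in L_{n,\varepsilon}}|\Gamma(y)|$; two distinct nodes $i,j$ are adjacent in $G_t$ if and only if $d(P_{i,t},P_{j,t})\le r$. Flooding from a source $s$ informs the nodes $I_0=\{s\}$ at time $0$, and $I_{t+1}$ consists of $I_t$ and of all neighbours in $G_{t+1}$ of nodes of $I_t$; the flooding time from $s$ is the least $t$ such that $I_t$ contains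 all nodes ($\infty$ if there is none). Theorem. For every $\varepsilon_0>0$ there are constants $r_0,c,C,a>0$ such that the following holds for all integers $n\ge 1$ and all real $\varepsilon,\rho,r$ with $0<\varepsilon\le\varepsilon_0$, $0<\rho\le\sqrt n$, $r\ge r_0$ and $\rho\ge c\sqrt{\log n}$: for every source $s$, with probability at least $1-n^{-a}$, the flooding time from $s$ in the stationary geometric-MEG $\mathcal{G}(n,\rho,r,\varepsilon)$ is at most $$C\left(\frac{\sqrt n}{\rho}+\log n\right).$$ -/

import Mathlib

open MeasureTheory
open scoped ENNReal

noncomputable section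

namespace GeoMEG

/-- Indices of the grid of resolution `ε` in the square of side `√n`: the pairs `(i, j)` of natural
numbers with `i, j ≤ √n / ε`. -/
abbrev Grid (n : ℕ) (ε : ℝ) : Type :=
  Fin (⌊√(n : ℝ) / ε⌋₊ + 1) × Fin (⌊√(n : ℝ) / ε⌋₊ + 1)

/-- The point `(i ε, j ε)` of the Euclidean plane with index `(i, j)`. -/
def point {n : ℕ} {ε : ℝ} (x : Grid n ε) : EuclideanSpace ℝ (Fin 2) :=
  !₂[(x.1 : ℝ) * ε, (x.2 : ℝ) * ε]

open Classical in
/-- `Γ(x)`: the grid positions at Euclidean distance at most `ρ` from `x` (including `x`). -/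
def moves {n : ℕ} {ε : ℝ} (ρ : ℝ) (x : Grid n ε) : Finset (Grid n ε) :=
  Finset.univ.filter fun y => dist (point x) (point y) ≤ ρ

open Classical in
/-- One-step transition probability of a single node: uniform on `Γ(x)`. -/
def moveProb {n : ℕ} {ε : ℝ} (ρ : ℝ) (x y : Grid n ε) : ℝ :=
  if y ∈ moves ρ x then 1 / ((moves ρ x).card : ℝ) else 0

/-- The stationary distribution of a single node: `|Γ(x)| / ∑ y, |Γ(y)|`. -/
def statProb {n : ℕ} {ε : ℝ} (ρ : ℝ) (x : Grid n ε) : ℝ :=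
  ((moves ρ x).card : ℝ) / ∑ y : Grid n ε, ((moves ρ y).card : ℝ)

/-- `P t ω i` is the position of node `i` at time `t`. The process is the stationary mobility chain
if its finite-dimensional distributions are those of `n` independent Markov chains, each with
transition probabilities `moveProb` and started from `statProb`. -/
structure IsStationaryMobility {Ω : Type*} [MeasurableSpace Ω] (μ : Measure Ω) (n : ℕ) (ρ ε : ℝ)
    (P : ℕ → Ω → Fin n → Grid n ε) : Prop where
  measurable : ∀ t, Measurable (P t)
  law : ∀ (t : ℕ) (x : ℕ → Fin n → Grid n ε),
    μ.real {ω | ∀ k ≤ t, P k ω = x k} =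
      ∏ i : Fin n, (statProb ρ (x 0 i) * ∏ k ∈ Finset.range t, moveProb ρ (x k i) (x (k + 1) i))

/-- The snapshot graph of the configuration `p` of positions: two distinct nodes are linked iff
their Euclidean distance is at most the transmission radius `r`. -/
def snapshot {n : ℕ} {ε : ℝ} (r : ℝ) (p : Fin n → Grid n ε) : SimpleGraph (Fin n) where
  Adj i j := i ≠ j ∧ dist (point (p i)) (point (p j)) ≤ r
  symm := ⟨fun _ _ h => ⟨h.1.symm, by rw [dist_comm]; exact h.2⟩⟩
  loopless := ⟨fun _ h => h.1 rfl⟩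

/-- The nodes informed after `t` time steps of flooding from `s` in the evolving graph `G`. In each
time step the graph is first updated (the nodes move), and then every informed node transmits to
its current neighbours. -/
def informed {V : Type*} (G : ℕ → SimpleGraph V) (s : V) : ℕ → Set V
  | 0 => {s}
  | t + 1 => informed G s t ∪ {v | ∃ u ∈ informed G s t, (G (t + 1)).Adj u v}

/-- The flooding time from `s`: the first time at which all nodes are informed, `⊤` if there is
none. -/
def floodingTime {V : Type*} (G : ℕ → SimpleGraph V) (s : V) : ℕ∞ :=
  ⨅ (t : ℕ) (_ : informed G s t = Set.univ), (t : ℕ∞)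

end GeoMEG

end

/-!
Flooding is fast for three reasons, one for each phase of the process. The square is cut into cells
of side of the order of `ρ`, so that a node can move to every place of its own cell and of the
adjacent cells, and each cell into `b ^ 2` tiles of constant side, so that the nodes of a tile are
linked. A move reaches a given tile of a nearby cell with probability at least `γ / b ^ 2`, where
`γ` is an absolute constant. In the stationary distribution the positions are independent at each
time, and every cell contains at least `θ b ^ 2` nodes, except with probability exponentially small in
`b ^ 2`; here `θ` is as large as needed if `r` is large, and `b ^ 2` is at least a large multiple of
`log n`.

The basic estimate is `Tiling.prodExp_spread_le`. Conditionally on the present configuration, `k`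
informed nodes near a cell hit at least a fraction of `k` different tiles of that cell in the next
step, and the numerous nodes of the cell have many chances to fall into these tiles. Both counts are
controlled by exponential moments, computed by resampling one coordinate at a time
(`prodExp_hit_le`, `prodExp_mul_half_pow_le`). So the number of informed nodes doubles, and the
doubling fails with probability exponentially small in `k` (`Tiling.prodExp_double_le`); a single
informed node still leads to any fixed number of informed nodes with constant probability
(`Tiling.prodExp_start_le`).

Call a cell saturated if it contains `b ^ 2` informed nodes.
* While no cell is saturated, a potential comparable to the inverse of the largest number of
  informed nodes in a cell decreases by a constant factor per step in expectation
  (`Tiling.floodOp_potential_le`). It lies between `b ^ (-2)` and `1`, so that a cell is saturated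
  after `O(log n)` steps. The expectation takes care of the failures of the early steps, which have
  constant probability.
* A saturated cell saturates its neighbours in the next step with overwhelming probability, so that
  all cells are saturated after another `O(√n / ρ)` steps (`Tiling.floodOp_ballSaturated_le`).
* Then every uninformed node is informed with constant probability in each step, and `O(log n)`
  steps inform all nodes (`Tiling.floodOp_uninformed_le`).

`Tiling.floodExp_uninformed_le` combines the three phases, and
`measureReal_informed_ne_univ_le` transfers the bound from the weights of finite paths to the given
process.
-/

namespace GeoMEG

/-! ### Expectations under a finite product of weights -/

section ProductWeights

variable {ι X : Type*} [Fintype ι] [DecidableEq ι] [Fintype X]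

/-- Expectation of `φ` when the coordinates `q i` are independent and `q i` has the weights
`w i`. -/
noncomputable def prodExp (w : ι → X → ℝ) (φ : (ι → X) → ℝ) : ℝ :=
  ∑ q, (∏ i, w i (q i)) * φ q

theorem prodExp_mono {w : ι → X → ℝ} (hw : ∀ i x, 0 ≤ w i x) {φ ψ : (ι → X) → ℝ}
    (h : ∀ q, φ q ≤ ψ q) : prodExp w φ ≤ prodExp w ψ :=
  Finset.sum_le_sum fun q _ =>
    mul_le_mul_of_nonneg_left (h q) (Finset.prod_nonneg fun i _ => hw i _)

theorem prodExp_add (w : ι → X → ℝ) (φ ψ : (ι → X) → ℝ) :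
    prodExp w (fun q => φ q + ψ q) = prodExp w φ + prodExp w ψ := by
  simp [prodExp, mul_add, Finset.sum_add_distrib]

theorem prodExp_const_mul (w : ι → X → ℝ) (c : ℝ) (φ : (ι → X) → ℝ) :
    prodExp w (fun q => c * φ q) = c * prodExp w φ := by
  simp only [prodExp, Finset.mul_sum]
  exact Finset.sum_congr rfl fun q _ => by ring

theorem prodExp_sum {κ : Type*} (w : ι → X → ℝ) (s : Finset κ) (φ : κ → (ι → X) → ℝ) :
    prodExp w (fun q => ∑ k ∈ s, φ k q) = ∑ k ∈ s, prodExp w (φ k) := by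
  simp only [prodExp, Finset.mul_sum]
  exact Finset.sum_comm

theorem prodExp_const {w : ι → X → ℝ} (hw : ∀ i, ∑ x, w i x = 1) (c : ℝ) :
    prodExp w (fun _ => c) = c := by
  have h : ∑ q : ι → X, ∏ i, w i (q i) = 1 := by
    rw [← Fintype.prod_sum]
    exact Finset.prod_eq_one fun i _ => hw i
  rw [prodExp, ← Finset.sum_mul, h, one_mul]

/-- Resampling one coordinate does not change an expectation. -/
theorem prodExp_resample {w : ι → X → ℝ} (hw : ∀ i, ∑ x, w i x = 1) (a : ι)
    (φ : (ι → X) → ℝ) :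
    prodExp w φ = prodExp w (fun q => ∑ x, w a x * φ (Function.update q a x)) := by
  have key : ∀ (q : ι → X) (x : X),
      (∏ i, w i (Function.update q a x i)) * w a (q a) = (∏ i, w i (q i)) * w a x := by
    intro q x
    rw [← Finset.mul_prod_erase _ _ (Finset.mem_univ a),
      ← Finset.mul_prod_erase Finset.univ (fun i => w i (q i)) (Finset.mem_univ a)]
    have : ∏ i ∈ Finset.univ.erase a, w i (Function.update q a x i) =
        ∏ i ∈ Finset.univ.erase a, w i (q i) :=
      Finset.prod_congr rfl fun i hi => by
        rw [Function.update_of_ne (Finset.ne_of_mem_erase hi)]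
    rw [this, Function.update_self]
    ring
  -- exchanging the old and the new value of the coordinate `a` preserves the joint weights
  let e : ((ι → X) × X) ≃ ((ι → X) × X) :=
    Function.Involutive.toPerm (fun z => (Function.update z.1 a z.2, z.1 a)) (by
      rintro ⟨q, x⟩
      simp)
  have h1 : prodExp w φ = ∑ z : (ι → X) × X, ((∏ i, w i (z.1 i)) * w a z.2) * φ z.1 := by
    rw [Fintype.sum_prod_type, prodExp]
    refine Finset.sum_congr rfl fun q _ => ?_
    simp only
    rw [← Finset.sum_mul, ← Finset.mul_sum, hw a, mul_one]
  have h2 : prodExp w (fun q => ∑ x, w a x * φ (Function.update q a x)) =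
      ∑ z : (ι → X) × X, ((∏ i, w i (z.1 i)) * w a z.2) * φ (e z).1 := by
    rw [Fintype.sum_prod_type, prodExp]
    refine Finset.sum_congr rfl fun q _ => ?_
    rw [Finset.mul_sum]
    exact Finset.sum_congr rfl fun x _ => by
      change _ = _ * φ (Function.update q a x)
      ring
  rw [h1, h2, ← Equiv.sum_comp e]
  refine Finset.sum_congr rfl fun z _ => ?_
  congr 1
  exact key z.1 z.2

/-- One step of an exponential moment estimate: if resampling the coordinate `a` multiplies the
conditional expectation by at most `c`, the expectation is multiplied by at most `c`. -/
theorem prodExp_le_of_resample {w : ι → X → ℝ} (hw0 : ∀ i x, 0 ≤ w i x)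
    (hw : ∀ i, ∑ x, w i x = 1) (a : ι) {φ ψ : (ι → X) → ℝ} {c : ℝ}
    (h : ∀ q, ∑ x, w a x * φ (Function.update q a x) ≤ c * ψ q) :
    prodExp w φ ≤ c * prodExp w ψ := by
  rw [prodExp_resample hw a, ← prodExp_const_mul]
  exact prodExp_mono hw0 h

/-- The mean of the function that is `1 / 2` on a set of weight at least `p` and `1` elsewhere. -/
theorem sum_mul_half_le {w : X → ℝ} (hw : ∑ x, w x = 1) {S : Set X} {p : ℝ}
    (hp : p ≤ ∑ x, w x * S.indicator 1 x) :
    ∑ x, w x * (1 - S.indicator 1 x / 2) ≤ 1 - p / 2 := by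
  have : ∑ x, w x * (1 - S.indicator 1 x / 2) =
      ∑ x, w x - (∑ x, w x * S.indicator 1 x) / 2 := by
    rw [Finset.sum_div, ← Finset.sum_sub_distrib]
    exact Finset.sum_congr rfl fun x _ => by ring
  rw [this, hw]
  linarith

open Classical in
/-- Exponential moment of the number of coordinates `i ∈ B` that fall into a set `S q` which is
itself random, but determined by the coordinates outside `B`; so is the factor `ψ`. -/
theorem prodExp_mul_half_pow_le {w : ι → X → ℝ} (hw0 : ∀ i x, 0 ≤ w i x)
    (hw : ∀ i, ∑ x, w i x = 1) {ψ : (ι → X) → ℝ} (hψ0 : ∀ q, 0 ≤ ψ q) {S : (ι → X) → Set X}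
    {p : ℝ} (hp2 : p ≤ 2) (B : Finset ι)
    (hS : ∀ q, ∀ i ∈ B, ∀ x, S (Function.update q i x) = S q)
    (hψ : ∀ q, ∀ i ∈ B, ∀ x, ψ (Function.update q i x) = ψ q)
    (hp : ∀ q, ∀ i ∈ B, ψ q ≠ 0 → p ≤ ∑ x, w i x * (S q).indicator 1 x) :
    prodExp w (fun q => ψ q * (1 / 2) ^ (B.filter fun i => q i ∈ S q).card) ≤
      (1 - p / 2) ^ B.card * prodExp w ψ := by
  have conv : ∀ (B : Finset ι) (q : ι → X), ((1 : ℝ) / 2) ^ (B.filter fun i => q i ∈ S q).card =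
      ∏ i ∈ B, (1 - (S q).indicator 1 (q i) / 2) := by
    intro B q
    rw [Finset.card_filter, ← Finset.prod_pow_eq_pow_sum]
    refine Finset.prod_congr rfl fun i _ => ?_
    by_cases h : q i ∈ S q <;> simp [h]
    norm_num
  simp only [conv]
  clear conv
  induction B using Finset.induction_on with
  | empty => simp
  | insert a B ha ih =>
    have ih' := ih (fun q i hi => hS q i (Finset.mem_insert_of_mem hi))
      (fun q i hi => hψ q i (Finset.mem_insert_of_mem hi))
      (fun q i hi => hp q i (Finset.mem_insert_of_mem hi))
    rw [Finset.card_insert_of_notMem ha, pow_succ', mul_assoc]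
    refine le_trans (prodExp_le_of_resample hw0 hw a (c := 1 - p / 2) (fun q => ?_))
      (mul_le_mul_of_nonneg_left ih' (by linarith))
    have hmem := Finset.mem_insert_self a B
    have e1 : ∀ x, ∏ i ∈ insert a B,
        (1 - (S (Function.update q a x)).indicator 1 (Function.update q a x i) / 2) =
        (1 - (S q).indicator 1 x / 2) * ∏ i ∈ B, (1 - (S q).indicator (1 : X → ℝ) (q i) / 2) := by
      intro x
      rw [Finset.prod_insert ha, hS q a hmem, Function.update_self]
      congr 1
      refine Finset.prod_congr rfl fun i hi => ?_
      rw [Function.update_of_ne (ne_of_mem_of_not_mem hi ha)]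
    set R := ∏ i ∈ B, (1 - (S q).indicator (1 : X → ℝ) (q i) / 2) with hR
    have hR0 : 0 ≤ R := Finset.prod_nonneg fun i _ => by
      by_cases h : q i ∈ S q <;> simp [h]
      norm_num
    have e2 : ∑ x, w a x * (ψ (Function.update q a x) * ∏ i ∈ insert a B,
        (1 - (S (Function.update q a x)).indicator 1 (Function.update q a x i) / 2)) =
        (∑ x, w a x * (1 - (S q).indicator 1 x / 2)) * (ψ q * R) := by
      rw [Finset.sum_mul]
      refine Finset.sum_congr rfl fun x _ => ?_
      rw [e1, hψ q a hmem]
      ring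
    rw [e2]
    by_cases h0 : ψ q = 0
    · simp [h0]
    · exact mul_le_mul_of_nonneg_right (sum_mul_half_le (hw a) (hp q a hmem h0))
        (mul_nonneg (hψ0 q) hR0)

/-- Weight of a union of fibres, each of weight at least `η`. -/
theorem card_mul_le_sum_indicator {Y : Type*} (σ : X → Y) {w : X → ℝ} {η : ℝ} (s : Finset Y)
    (h : ∀ τ ∈ s, η ≤ ∑ x, w x * {x | σ x = τ}.indicator 1 x) :
    s.card * η ≤ ∑ x, w x * {x | σ x ∈ s}.indicator 1 x := by
  classical
  calc (s.card : ℝ) * η = ∑ τ ∈ s, η := by simp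
    _ ≤ ∑ τ ∈ s, ∑ x, w x * {x | σ x = τ}.indicator 1 x := Finset.sum_le_sum h
    _ = ∑ x, w x * {x | σ x ∈ s}.indicator 1 x := by
      rw [Finset.sum_comm]
      refine Finset.sum_congr rfl fun x _ => ?_
      rw [← Finset.mul_sum]
      congr 1
      simp [Set.indicator_apply]

/-- Exponential moment of the number of elements of `K` that are hit by the coordinates in `A`,
as long as this number is at most `L`: up to then each further coordinate hits a new element with
probability at least `(#K - L) η`. -/
theorem prodExp_hit_le {Y : Type*} [DecidableEq Y] {w : ι → X → ℝ} (hw0 : ∀ i x, 0 ≤ w i x)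
    (hw : ∀ i, ∑ x, w i x = 1) (σ : X → Y) (K : Finset Y) {η : ℝ} (hη : 0 ≤ η) (L : ℕ) {p : ℝ}
    (hp : p ≤ ((K.card : ℝ) - L) * η) (hp2 : p ≤ 2) (A : Finset ι)
    (h : ∀ i ∈ A, ∀ τ ∈ K, η ≤ ∑ x, w i x * {x | σ x = τ}.indicator 1 x) :
    prodExp w (fun q => if (K ∩ A.image (σ ∘ q)).card ≤ L
      then (1 / 2 : ℝ) ^ (K ∩ A.image (σ ∘ q)).card else 0) ≤ (1 - p / 2) ^ A.card := by
  induction A using Finset.induction_on with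
  | empty => simpa using (prodExp_const hw 1).le
  | insert a A ha ih =>
    have ih' := ih (fun i hi => h i (Finset.mem_insert_of_mem hi))
    rw [Finset.card_insert_of_notMem ha, pow_succ']
    refine le_trans (prodExp_le_of_resample hw0 hw a (c := 1 - p / 2) (fun q => ?_))
      (mul_le_mul_of_nonneg_left ih' (by linarith))
    set D := K ∩ A.image (σ ∘ q) with hD
    have himg : ∀ x, (insert a A).image (σ ∘ Function.update q a x) =
        insert (σ x) (A.image (σ ∘ q)) := by
      intro x
      rw [Finset.image_insert]
      congr 1
      · simp
      · refine Finset.image_congr fun i hi => ?_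
        simp only [Function.comp]
        rw [Function.update_of_ne (ne_of_mem_of_not_mem (Finset.mem_coe.1 hi) ha)]
    simp only [himg]
    have hx : ∀ x, (if (K ∩ insert (σ x) (A.image (σ ∘ q))).card ≤ L
        then (1 / 2 : ℝ) ^ (K ∩ insert (σ x) (A.image (σ ∘ q))).card else 0) ≤
        (1 - {x | σ x ∈ K \ D}.indicator 1 x / 2) *
          (if D.card ≤ L then (1 / 2 : ℝ) ^ D.card else 0) := by
      intro x
      by_cases hK : σ x ∈ K
      · rw [Finset.inter_insert_of_mem hK, ← hD]
        by_cases hxD : σ x ∈ D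
        · simp [Finset.insert_eq_of_mem hxD, hxD]
        · rw [Finset.card_insert_of_notMem hxD, Set.indicator_of_mem (by simp [hK, hxD])]
          split_ifs with h1 h2 h2
          · rw [pow_succ']; norm_num
          · omega
          · norm_num
          · norm_num
      · rw [Finset.inter_insert_of_notMem hK, ← hD, Set.indicator_of_notMem (by simp [hK])]
        simp
    calc _ ≤ ∑ x, w a x * ((1 - {x | σ x ∈ K \ D}.indicator 1 x / 2) *
          (if D.card ≤ L then (1 / 2 : ℝ) ^ D.card else 0)) :=
        Finset.sum_le_sum fun x _ => mul_le_mul_of_nonneg_left (hx x) (hw0 a x)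
      _ = (∑ x, w a x * (1 - {x | σ x ∈ K \ D}.indicator 1 x / 2)) *
          (if D.card ≤ L then (1 / 2 : ℝ) ^ D.card else 0) := by
        rw [Finset.sum_mul]
        exact Finset.sum_congr rfl fun x _ => by ring
      _ ≤ _ := by
        split_ifs with hL
        · refine mul_le_mul_of_nonneg_right (sum_mul_half_le (hw a) ?_) (by positivity)
          refine hp.trans (le_trans (mul_le_mul_of_nonneg_right ?_ hη)
            (card_mul_le_sum_indicator σ (K \ D) fun τ hτ =>
              h a (Finset.mem_insert_self a A) τ (Finset.mem_sdiff.1 hτ).1))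
          rw [Finset.cast_card_sdiff Finset.inter_subset_left]
          have : (D.card : ℝ) ≤ L := by exact_mod_cast hL
          linarith
        · simp

end ProductWeights

/-! ### Tilings of the position space and the spreading step -/

/-- Indices of an `M × M` array of cells. -/
def cells (M : ℕ) : Finset (ℕ × ℕ) := Finset.range M ×ˢ Finset.range M

/-- Two cell indices that are equal or adjacent, diagonally adjacent ones included. -/
def Near (Q Q' : ℕ × ℕ) : Prop :=
  (Q.1 ≤ Q'.1 + 1 ∧ Q'.1 ≤ Q.1 + 1) ∧ (Q.2 ≤ Q'.2 + 1 ∧ Q'.2 ≤ Q.2 + 1)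

theorem Near.refl (Q : ℕ × ℕ) : Near Q Q := by
  unfold Near
  omega

/-- A two-level partition of the positions `X` of a node that moves with transition probabilities
`w`: `M × M` cells, each of which contains `b ^ 2` core tiles, such that a move from a cell reaches
each core tile of the cell itself and of the adjacent cells with probability at least `γ / b ^ 2`.
The tiles are meant to be so small that two nodes in the same tile are linked. A cell may contain
positions outside its core tiles. -/
structure Tiling (X : Type*) [Fintype X] (w : X → X → ℝ) (M b : ℕ) (γ : ℝ) where
  /-- The cell of a position. -/
  cell : X → ℕ × ℕ
  /-- The tile of a position. -/
  tile : X → ℕ × ℕ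
  /-- The core tiles of a cell. -/
  core : ℕ × ℕ → Finset (ℕ × ℕ)
  cell_mem : ∀ x, cell x ∈ cells M
  card_core : ∀ Q, (core Q).card = b ^ 2
  cell_eq : ∀ Q ∈ cells M, ∀ x, tile x ∈ core Q → cell x = Q
  le_move : ∀ x, ∀ Q ∈ cells M, Near (cell x) Q → ∀ τ ∈ core Q,
    γ / (b : ℝ) ^ 2 ≤ ∑ y, w x y * {y | tile y = τ}.indicator 1 y

/-- `step I q` is the informed set after a time step in which the nodes move to `q` and the nodes
in `I` transmit. All that is used of it is that no node is forgotten and that informed nodes inform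
their own tiles. -/
structure Transmits {V X : Type*} (tile : X → ℕ × ℕ) (step : Set V → (V → X) → Set V) : Prop where
  subset : ∀ I q, I ⊆ step I q
  mem : ∀ I q u v, u ∈ I → tile (q u) = tile (q v) → v ∈ step I q

section Step

variable {V X : Type*} [Fintype V] [Fintype X] {w : X → X → ℝ} {M b : ℕ} {γ : ℝ}

open Classical in
/-- The spreading step. The informed nodes `A` near the cell `Q` hit more than `h` core tiles of
`Q`, up to an exceptional event, and then each of the nodes in `B` lands in one of these tiles with
probability at least `(h + 1) γ / b ^ 2`. -/
theorem Tiling.prodExp_spread_le [DecidableEq V] (T : Tiling X w M b γ)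
    {step : Set V → (V → X) → Set V}
    (hstep : Transmits T.tile step) (hw0 : ∀ x y, 0 ≤ w x y) (hw : ∀ x, ∑ y, w x y = 1)
    (hγ : 0 < γ) (hγ1 : γ ≤ 1) (hb : 2 ≤ b) (p : V → X) (I : Set V) {Q : ℕ × ℕ}
    (hQ : Q ∈ cells M) (A B : Finset V) (hAB : Disjoint A B)
    (hA : ∀ i ∈ A, i ∈ I ∧ Near (T.cell (p i)) Q) (hB : ∀ i ∈ B, Near (T.cell (p i)) Q)
    (h m : ℕ) (hh : 2 * h ≤ b ^ 2) :
    prodExp (fun i => w (p i))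
      ({q | (B.filter fun i => i ∈ step I q ∧ T.cell (q i) = Q).card ≤ m}.indicator 1) ≤
      2 ^ h * (1 - γ / 4) ^ A.card +
        2 ^ m * (1 - (h + 1) * (γ / (b : ℝ) ^ 2) / 2) ^ B.card := by
  set w' : V → X → ℝ := fun i => w (p i) with hw'
  have hw0' : ∀ i x, 0 ≤ w' i x := fun i x => hw0 _ _
  have hw1' : ∀ i, ∑ x, w' i x = 1 := fun i => hw _
  have hb2 : (4 : ℝ) ≤ (b : ℝ) ^ 2 := by
    have : (2 : ℝ) ≤ b := by exact_mod_cast hb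
    nlinarith
  have hh' : 2 * (h : ℝ) ≤ (b : ℝ) ^ 2 := by exact_mod_cast hh
  set H : (V → X) → ℕ := fun q => (T.core Q ∩ A.image (T.tile ∘ q)).card with hH
  obtain ⟨S, hS⟩ : ∃ S : (V → X) → Set X,
      S = fun q => {x | T.tile x ∈ T.core Q ∩ A.image (T.tile ∘ q)} := ⟨_, rfl⟩
  set ψ : (V → X) → ℝ := fun q => if H q ≤ h then 0 else 1 with hψ
  set f : (V → X) → ℝ := fun q => if H q ≤ h then (1 / 2 : ℝ) ^ H q else 0 with hf
  have him : ∀ q, ∀ i ∈ B, ∀ x, A.image (T.tile ∘ Function.update q i x) =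
      A.image (T.tile ∘ q) := by
    intro q i hi x
    refine Finset.image_congr fun j hj => ?_
    simp only [Function.comp]
    rw [Function.update_of_ne]
    rintro rfl
    exact Finset.disjoint_left.1 hAB (Finset.mem_coe.1 hj) hi
  have h1 : prodExp w' f ≤ (1 - γ / 4) ^ A.card := by
    have := prodExp_hit_le hw0' hw1' T.tile (T.core Q) (η := γ / (b : ℝ) ^ 2) (by positivity) h
      (p := γ / 2) ?_ (by linarith) A (fun i hi τ hτ => T.le_move _ Q hQ (hA i hi).2 τ hτ)
    · rwa [div_div, show (2 : ℝ) * 2 = 4 by norm_num] at this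
    · rw [T.card_core, mul_div_assoc', le_div_iff₀ (by positivity)]
      push_cast
      nlinarith
  have h2 : prodExp w' (fun q => ψ q * (1 / 2) ^ (B.filter fun i => q i ∈ S q).card) ≤
      (1 - (h + 1) * (γ / (b : ℝ) ^ 2) / 2) ^ B.card := by
    have := prodExp_mul_half_pow_le hw0' hw1' (ψ := ψ) (fun q => by
      simp only [hψ]; split_ifs <;> norm_num) (S := S) (p := (h + 1) * (γ / (b : ℝ) ^ 2)) ?_ B ?_ ?_
      ?_
    · refine this.trans (mul_le_of_le_one_right (pow_nonneg ?_ _) ?_)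
      · have : (h + 1) * (γ / (b : ℝ) ^ 2) ≤ 1 := by
          rw [mul_div_assoc', div_le_one (by positivity)]
          nlinarith
        linarith
      · rw [← prodExp_const hw1' 1]
        refine prodExp_mono hw0' fun q => ?_
        simp only [hψ]; split_ifs <;> norm_num
    · rw [mul_div_assoc', div_le_iff₀ (by positivity)]
      nlinarith
    · intro q i hi x
      simp only [hS, him q i hi x]
    · intro q i hi x
      simp only [hψ, hH, him q i hi x]
    · intro q i hi hq
      have hq' : h + 1 ≤ H q := by
        by_contra hc
        exact hq (by simp only [hψ]; rw [if_pos (by omega)])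
      rw [hS]
      refine le_trans ?_
        (card_mul_le_sum_indicator T.tile (T.core Q ∩ A.image (T.tile ∘ q)) fun τ hτ =>
          T.le_move _ Q hQ (hB i hi) τ (Finset.mem_inter.1 hτ).1)
      exact mul_le_mul_of_nonneg_right (by exact_mod_cast hq') (by positivity)
  have hsub : ∀ q, (B.filter fun i => q i ∈ S q) ⊆
      B.filter fun i => i ∈ step I q ∧ T.cell (q i) = Q := by
    intro q i hi
    obtain ⟨hiB, hiS⟩ := Finset.mem_filter.1 hi
    rw [hS] at hiS
    obtain ⟨hc, ha⟩ := Finset.mem_inter.1 hiS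
    obtain ⟨a, haA, hai⟩ := Finset.mem_image.1 ha
    exact Finset.mem_filter.2 ⟨hiB, hstep.mem I q a i (hA a haA).1 hai, T.cell_eq Q hQ _ hc⟩
  calc _ ≤ prodExp w' (fun q => 2 ^ h * f q +
        2 ^ m * (ψ q * (1 / 2) ^ (B.filter fun i => q i ∈ S q).card)) := by
        refine prodExp_mono hw0' fun q => ?_
        have pow_one_le : ∀ j k : ℕ, j ≤ k → (1 : ℝ) ≤ 2 ^ k * (1 / 2) ^ j := by
          intro j k hjk
          rw [one_div, inv_pow, ← div_eq_mul_inv, one_le_div (by positivity)]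
          exact pow_le_pow_right₀ (by norm_num) hjk
        by_cases hq : q ∈ {q | (B.filter fun i => i ∈ step I q ∧ T.cell (q i) = Q).card ≤ m}
        · rw [Set.indicator_of_mem hq, Pi.one_apply]
          by_cases hc : H q ≤ h
          · simp only [hf, hψ, hc, if_true]
            have := pow_one_le _ _ hc
            linarith
          · simp only [hf, hψ, hc, if_false]
            have := pow_one_le _ _ ((Finset.card_le_card (hsub q)).trans hq)
            linarith
        · rw [Set.indicator_of_notMem hq]
          have : 0 ≤ f q := by simp only [hf]; split_ifs <;> positivity
          have : 0 ≤ ψ q := by simp only [hψ]; split_ifs <;> positivity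
          positivity
    _ ≤ _ := by
        rw [prodExp_add, prodExp_const_mul, prodExp_const_mul]
        gcongr

open Classical in
/-- The nodes of `I` that are in the cell `Q` in the configuration `p`. -/
noncomputable def Tiling.inCell (T : Tiling X w M b γ) (p : V → X) (I : Set V) (Q : ℕ × ℕ) :
    Finset V :=
  Finset.univ.filter fun i => i ∈ I ∧ T.cell (p i) = Q

theorem Tiling.mem_inCell (T : Tiling X w M b γ) {p : V → X} {I : Set V} {Q : ℕ × ℕ} {i : V} :
    i ∈ T.inCell p I Q ↔ i ∈ I ∧ T.cell (p i) = Q := by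
  simp [Tiling.inCell]

/-- Every cell contains at least `θ b ^ 2` nodes. -/
def Tiling.Dense (T : Tiling X w M b γ) (θ : ℝ) (p : V → X) : Prop :=
  ∀ Q ∈ cells M, θ * (b : ℝ) ^ 2 ≤ (T.inCell p Set.univ Q).card

theorem one_sub_pow_le_exp {x : ℝ} (hx : x ≤ 1) (k : ℕ) :
    (1 - x) ^ k ≤ Real.exp (-(k * x)) := by
  rw [← mul_neg, Real.exp_nat_mul]
  exact pow_le_pow_left₀ (by linarith) (Real.one_sub_le_exp_neg x) k

theorem two_pow_le_exp (k : ℕ) : (2 : ℝ) ^ k ≤ Real.exp k := by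
  rw [← mul_one (k : ℝ), Real.exp_nat_mul]
  exact pow_le_pow_left₀ (by norm_num) (by have := Real.add_one_le_exp 1; linarith) k

/-- The spreading step in a dense configuration, with the uninformed nodes of the target cell as
receivers. -/
theorem Tiling.prodExp_inCell_le [DecidableEq V] (T : Tiling X w M b γ)
    {step : Set V → (V → X) → Set V}
    (hstep : Transmits T.tile step) (hw0 : ∀ x y, 0 ≤ w x y) (hw : ∀ x, ∑ y, w x y = 1)
    (hγ : 0 < γ) (hγ1 : γ ≤ 1) (hb : 2 ≤ b) {θ : ℝ} {p : V → X} (hp : T.Dense (θ + 1) p)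
    (I : Set V) {Q : ℕ × ℕ} (hQ : Q ∈ cells M) (A : Finset V)
    (hA : ∀ i ∈ A, i ∈ I ∧ Near (T.cell (p i)) Q) (hAb : A.card ≤ b ^ 2)
    (h m : ℕ) (hh : 2 * h ≤ b ^ 2) :
    prodExp (fun i => w (p i)) ({q | (T.inCell q (step I q) Q).card ≤ m}.indicator 1) ≤
      2 ^ h * (1 - γ / 4) ^ A.card + 2 ^ m * Real.exp (-((h + 1) * γ * θ / 2)) := by
  classical
  have hb2 : (4 : ℝ) ≤ (b : ℝ) ^ 2 := by
    have : (2 : ℝ) ≤ b := by exact_mod_cast hb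
    nlinarith
  have hh' : 2 * (h : ℝ) ≤ (b : ℝ) ^ 2 := by exact_mod_cast hh
  set B := T.inCell p Set.univ Q \ A with hB
  have hBc : θ * (b : ℝ) ^ 2 ≤ B.card := by
    have h1 := hp Q hQ
    have h2 : (T.inCell p Set.univ Q).card ≤ B.card + A.card := by
      rw [hB]; exact Finset.card_le_card_sdiff_add_card
    have h3 : ((T.inCell p Set.univ Q).card : ℝ) ≤ B.card + (b : ℝ) ^ 2 := by
      exact_mod_cast h2.trans (by omega)
    linarith
  have main := T.prodExp_spread_le hstep hw0 hw hγ hγ1 hb p I hQ A B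
    (hB ▸ Finset.disjoint_sdiff) hA (fun i hi => by
      rw [(T.mem_inCell.1 (Finset.mem_sdiff.1 hi).1).2]
      exact Near.refl Q) h m hh
  refine (prodExp_mono (fun i x => hw0 _ _) fun q => ?_).trans (main.trans ?_)
  · refine Set.indicator_le_indicator_of_subset (fun q hq => ?_) (fun _ => by simp) q
    refine le_trans (Finset.card_le_card fun i hi => ?_) hq
    exact T.mem_inCell.2 (Finset.mem_filter.1 hi).2
  · have hx : ((h : ℝ) + 1) * (γ / (b : ℝ) ^ 2) / 2 ≤ 1 := by
      rw [mul_div_assoc', div_div, div_le_one (by positivity)]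
      nlinarith
    have := one_sub_pow_le_exp hx B.card
    gcongr
    refine this.trans (Real.exp_le_exp.2 (neg_le_neg ?_))
    calc ((h : ℝ) + 1) * γ * θ / 2 =
        (θ * (b : ℝ) ^ 2) * (((h : ℝ) + 1) * (γ / (b : ℝ) ^ 2) / 2) := by
          field_simp
      _ ≤ _ := by gcongr

/-- `k` informed nodes near a cell of a dense configuration produce more than `2 k` informed nodes
in that cell, up to probability exponentially small in `k`. -/
theorem Tiling.prodExp_double_le [DecidableEq V] (T : Tiling X w M b γ)
    {step : Set V → (V → X) → Set V}
    (hstep : Transmits T.tile step) (hw0 : ∀ x y, 0 ≤ w x y) (hw : ∀ x, ∑ y, w x y = 1)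
    (hγ : 0 < γ) (hγ1 : γ ≤ 1) (hb : 2 ≤ b) {θ : ℝ} {p : V → X} (hp : T.Dense (θ + 1) p)
    (hθ : 48 / γ ^ 2 ≤ θ) (I : Set V) {Q : ℕ × ℕ} (hQ : Q ∈ cells M) (A : Finset V)
    (hA : ∀ i ∈ A, i ∈ I ∧ Near (T.cell (p i)) Q) (hAb : A.card ≤ b ^ 2) :
    prodExp (fun i => w (p i)) ({q | (T.inCell q (step I q) Q).card ≤ 2 * A.card}.indicator 1) ≤
      2 * Real.exp (-(γ * A.card / 8)) := by
  have hθ0 : 0 ≤ θ := le_trans (by positivity) hθ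
  set k := A.card with hk
  have hfl : (⌊γ * k / 8⌋₊ : ℝ) ≤ γ * k / 8 := Nat.floor_le (by positivity)
  have hfl' := Nat.lt_floor_add_one (γ * k / 8)
  have hkb : (k : ℝ) ≤ (b : ℝ) ^ 2 := by exact_mod_cast hAb
  have hk0 : (0 : ℝ) ≤ k := Nat.cast_nonneg k
  have hh : 2 * ⌊γ * k / 8⌋₊ ≤ b ^ 2 := by
    have : 2 * (⌊γ * k / 8⌋₊ : ℝ) ≤ (b : ℝ) ^ 2 := by nlinarith
    exact_mod_cast this
  refine (T.prodExp_inCell_le hstep hw0 hw hγ hγ1 hb hp I hQ A hA hAb _ (2 * k) hh).trans ?_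
  rw [two_mul (Real.exp _)]
  refine add_le_add ?_ ?_
  · calc (2 : ℝ) ^ ⌊γ * k / 8⌋₊ * (1 - γ / 4) ^ k
        ≤ Real.exp ⌊γ * k / 8⌋₊ * Real.exp (-(k * (γ / 4))) := by
          exact mul_le_mul (two_pow_le_exp _) (one_sub_pow_le_exp (by linarith) _)
            (pow_nonneg (by linarith) _) (Real.exp_pos _).le
      _ ≤ _ := by
          rw [← Real.exp_add]
          exact Real.exp_le_exp.2 (by linarith)
  · calc (2 : ℝ) ^ (2 * k) * Real.exp (-((⌊γ * k / 8⌋₊ + 1) * γ * θ / 2))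
        ≤ Real.exp (2 * k : ℕ) * Real.exp (-((γ * k / 8) * γ * θ / 2)) := by
          gcongr
          exact two_pow_le_exp _
      _ ≤ _ := by
          rw [← Real.exp_add]
          refine Real.exp_le_exp.2 ?_
          have h1 : 48 ≤ γ ^ 2 * θ := by
            rw [div_le_iff₀ (by positivity)] at hθ
            linarith
          push_cast
          nlinarith

/-- A single informed node produces more than `m` informed nodes in its cell with probability
bounded below, however large `m` is, provided the density is large enough. -/
theorem Tiling.prodExp_start_le [DecidableEq V] (T : Tiling X w M b γ)
    {step : Set V → (V → X) → Set V}
    (hstep : Transmits T.tile step) (hw0 : ∀ x y, 0 ≤ w x y) (hw : ∀ x, ∑ y, w x y = 1)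
    (hγ : 0 < γ) (hγ1 : γ ≤ 1) (hb : 2 ≤ b) {θ : ℝ} {p : V → X} (hp : T.Dense (θ + 1) p)
    (m : ℕ) (hθ : 2 * (m + 8 / γ) / γ ≤ θ) (I : Set V) {s : V} (hs : s ∈ I) :
    prodExp (fun i => w (p i))
      ({q | (T.inCell q (step I q) (T.cell (p s))).card ≤ m}.indicator 1) ≤ 1 - γ / 8 := by
  refine (T.prodExp_inCell_le hstep hw0 hw hγ hγ1 hb hp I (T.cell_mem _) {s} (by
    simp [hs, Near.refl]) (by simpa using Nat.one_le_pow _ _ (by omega)) 0 m (by simp)).trans ?_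
  have h1 : (2 : ℝ) ^ m * Real.exp (-(((0 : ℕ) + 1) * γ * θ / 2)) ≤ γ / 8 := by
    calc (2 : ℝ) ^ m * Real.exp (-(((0 : ℕ) + 1) * γ * θ / 2))
        ≤ Real.exp m * Real.exp (-(m + 8 / γ)) := by
          gcongr
          · exact two_pow_le_exp _
          · rw [div_le_iff₀ hγ] at hθ
            push_cast
            linarith
      _ = Real.exp (-(8 / γ)) := by
          rw [← Real.exp_add]
          ring_nf
      _ ≤ γ / 8 := by
          rw [Real.exp_neg, ← inv_div 8 γ]
          refine inv_anti₀ (by positivity) ?_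
          have := Real.add_one_le_exp (8 / γ)
          linarith
  simp only [pow_zero, Finset.card_singleton, pow_one, one_mul]
  linarith

/-- An uninformed node whose cell contains `b ^ 2` informed nodes becomes informed with probability
bounded below. -/
theorem Tiling.prodExp_notMem_le [DecidableEq V] (T : Tiling X w M b γ)
    {step : Set V → (V → X) → Set V}
    (hstep : Transmits T.tile step) (hw0 : ∀ x y, 0 ≤ w x y) (hw : ∀ x, ∑ y, w x y = 1)
    (hγ : 0 < γ) (hγ1 : γ ≤ 1) (hb : 2 ≤ b) (hbγ : Real.exp (-(γ * b ^ 2 / 8)) ≤ γ ^ 2 / 32)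
    {p : V → X} (I : Set V) {v : V} (hv : v ∉ I)
    (hsat : b ^ 2 ≤ (T.inCell p I (T.cell (p v))).card) :
    prodExp (fun i => w (p i)) ({q | v ∉ step I q}.indicator 1) ≤ 1 - γ ^ 2 / 32 := by
  classical
  obtain ⟨A, hAs, hAc⟩ := Finset.exists_subset_card_eq hsat
  have hvA : Disjoint A {v} := by
    rw [Finset.disjoint_singleton_right]
    exact fun h => hv (T.mem_inCell.1 (hAs h)).1
  have hfl : (⌊γ * b ^ 2 / 8⌋₊ : ℝ) ≤ γ * b ^ 2 / 8 := Nat.floor_le (by positivity)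
  have hfl' := Nat.lt_floor_add_one (γ * b ^ 2 / 8)
  have hb2 : (4 : ℝ) ≤ (b : ℝ) ^ 2 := by
    have : (2 : ℝ) ≤ b := by exact_mod_cast hb
    nlinarith
  have hh : 2 * ⌊γ * b ^ 2 / 8⌋₊ ≤ b ^ 2 := by
    have : 2 * (⌊γ * b ^ 2 / 8⌋₊ : ℝ) ≤ (b : ℝ) ^ 2 := by nlinarith
    exact_mod_cast this
  have main := T.prodExp_spread_le hstep hw0 hw hγ hγ1 hb p I (T.cell_mem (p v)) A {v} hvA
    (fun i hi => ⟨(T.mem_inCell.1 (hAs hi)).1, by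
      rw [(T.mem_inCell.1 (hAs hi)).2]; exact Near.refl _⟩)
    (fun i hi => by rw [Finset.mem_singleton.1 hi]; exact Near.refl _) _ 0 hh
  refine (prodExp_mono (fun i x => hw0 _ _) fun q => ?_).trans (main.trans ?_)
  · refine Set.indicator_le_indicator_of_subset (fun q hq => ?_) (fun _ => by simp) q
    have : v ∉ step I q := hq
    simp [Finset.filter_singleton, this]
  · rw [hAc, Finset.card_singleton, pow_one, pow_zero, one_mul]
    have h1 : (2 : ℝ) ^ ⌊γ * b ^ 2 / 8⌋₊ * (1 - γ / 4) ^ (b ^ 2) ≤ γ ^ 2 / 32 := by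
      refine le_trans ?_ hbγ
      calc (2 : ℝ) ^ ⌊γ * b ^ 2 / 8⌋₊ * (1 - γ / 4) ^ (b ^ 2)
          ≤ Real.exp ⌊γ * b ^ 2 / 8⌋₊ * Real.exp (-((b ^ 2 : ℕ) * (γ / 4))) := by
            exact mul_le_mul (two_pow_le_exp _) (one_sub_pow_le_exp (by linarith) _)
              (pow_nonneg (by linarith) _) (Real.exp_pos _).le
        _ ≤ _ := by
            rw [← Real.exp_add]
            push_cast
            exact Real.exp_le_exp.2 (by linarith)
    have h2 : γ ^ 2 / 8 ≤ ((⌊γ * b ^ 2 / 8⌋₊ : ℝ) + 1) * (γ / (b : ℝ) ^ 2) := by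
      rw [mul_div_assoc', le_div_iff₀ (by positivity)]
      nlinarith
    linarith

end Step

/-! ### The joint chain of positions and informed nodes -/

section Chain

variable {V X : Type*} [Fintype V] [DecidableEq V] [Fintype X]

/-- The transition operator of the chain of positions and informed sets: the conditional expectation
of `f` after one time step. -/
noncomputable def floodOp (w : X → X → ℝ) (step : Set V → (V → X) → Set V)
    (f : (V → X) × Set V → ℝ) (z : (V → X) × Set V) : ℝ :=
  prodExp (fun i => w (z.1 i)) fun q => f (q, step z.2 q)

/-- The expectation of `f` at time `t`, when the initial positions are independent with weights `π`
and the node `s` is the only one informed. -/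
noncomputable def floodExp (w : X → X → ℝ) (step : Set V → (V → X) → Set V) (π : X → ℝ) (s : V)
    (t : ℕ) (f : (V → X) × Set V → ℝ) : ℝ :=
  prodExp (fun _ => π) fun p => ((floodOp w step)^[t] f) (p, {s})

variable {w : X → X → ℝ} {step : Set V → (V → X) → Set V} {π : X → ℝ} {s : V}

theorem floodExp_succ (t : ℕ) (f : (V → X) × Set V → ℝ) :
    floodExp w step π s (t + 1) f = floodExp w step π s t (floodOp w step f) := rfl

theorem floodExp_mono (hw0 : ∀ x y, 0 ≤ w x y) (hπ0 : ∀ x, 0 ≤ π x) (hstep : ∀ I q, I ⊆ step I q)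
    {f g : (V → X) × Set V → ℝ} (h : ∀ z, s ∈ z.2 → f z ≤ g z) (t : ℕ) :
    floodExp w step π s t f ≤ floodExp w step π s t g := by
  refine prodExp_mono (fun _ => hπ0) fun p => ?_
  have : ∀ (t : ℕ) (f g : (V → X) × Set V → ℝ), (∀ z, s ∈ z.2 → f z ≤ g z) →
      ∀ z, s ∈ z.2 → ((floodOp w step)^[t] f) z ≤ ((floodOp w step)^[t] g) z := by
    intro t
    induction t with
    | zero => exact fun f g h => h
    | succ t ih =>
      intro f g h
      exact ih _ _ fun z hz => prodExp_mono (fun _ _ => hw0 _ _) fun q =>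
        h (q, step z.2 q) (hstep _ _ hz)
  exact this t f g h _ rfl

theorem floodExp_add (t : ℕ) (f g : (V → X) × Set V → ℝ) :
    floodExp w step π s t (fun z => f z + g z) =
      floodExp w step π s t f + floodExp w step π s t g := by
  induction t generalizing f g with
  | zero => exact prodExp_add _ _ _
  | succ t ih =>
    simp only [floodExp_succ]
    rw [← ih]
    congr 1
    funext z
    exact prodExp_add _ _ _

theorem floodExp_const_mul (t : ℕ) (c : ℝ) (f : (V → X) × Set V → ℝ) :
    floodExp w step π s t (fun z => c * f z) = c * floodExp w step π s t f := by
  induction t generalizing f with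
  | zero => exact prodExp_const_mul _ _ _
  | succ t ih =>
    simp only [floodExp_succ]
    rw [← ih]
    congr 1
    funext z
    exact prodExp_const_mul _ _ _

theorem floodExp_const (hw : ∀ x, ∑ y, w x y = 1) (hπ : ∑ x, π x = 1) (t : ℕ) (c : ℝ) :
    floodExp w step π s t (fun _ => c) = c := by
  induction t with
  | zero => exact prodExp_const (fun _ => hπ) c
  | succ t ih =>
    rw [floodExp_succ]
    convert ih using 2
    funext z
    exact prodExp_const (fun _ => hw _) c

/-- The product of the weights `π` is stationary for independent moves if `π` is stationary for one
move. -/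
theorem prodExp_prodExp_of_stationary (hstat : ∀ y, ∑ x, π x * w x y = π y) (g : (V → X) → ℝ) :
    prodExp (fun _ => π) (fun p => prodExp (fun i => w (p i)) g) = prodExp (fun _ => π) g := by
  simp only [prodExp, Finset.mul_sum]
  rw [Finset.sum_comm]
  refine Finset.sum_congr rfl fun q _ => ?_
  have : ∑ p : V → X, ∏ i, π (p i) * w (p i) (q i) = ∏ i, π (q i) := by
    rw [← Fintype.prod_sum (fun i x => π x * w x (q i))]
    exact Finset.prod_congr rfl fun i _ => hstat _
  rw [← this, Finset.sum_mul]
  refine Finset.sum_congr rfl fun p _ => ?_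
  rw [Finset.prod_mul_distrib]
  ring

theorem floodExp_fst (hstat : ∀ y, ∑ x, π x * w x y = π y) (t : ℕ) (g : (V → X) → ℝ) :
    floodExp w step π s t (fun z => g z.1) = prodExp (fun _ => π) g := by
  induction t generalizing g with
  | zero => rfl
  | succ t ih =>
    rw [floodExp_succ]
    exact (ih fun p => prodExp (fun i => w (p i)) g).trans (prodExp_prodExp_of_stationary hstat g)

end Chain

/-! ### Drift inequalities for the three phases of flooding -/

theorem indicator_one_nonneg {α : Type*} (S : Set α) (x : α) : (0 : ℝ) ≤ S.indicator 1 x :=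
  Set.indicator_nonneg (fun _ _ => zero_le_one) x

theorem indicator_one_le {α : Type*} (S : Set α) (x : α) : S.indicator (1 : α → ℝ) x ≤ 1 :=
  Set.indicator_le' (fun _ _ => le_rfl) (fun _ _ => zero_le_one) x

/-- `Q'` is within Chebyshev distance `j` of `Q`. -/
def Within (j : ℕ) (Q Q' : ℕ × ℕ) : Prop :=
  (Q.1 ≤ Q'.1 + j ∧ Q'.1 ≤ Q.1 + j) ∧ (Q.2 ≤ Q'.2 + j ∧ Q'.2 ≤ Q.2 + j)

theorem exists_within_near {M j : ℕ} {Q₀ Q : ℕ × ℕ} (h₀ : Q₀ ∈ cells M) (hQ : Q ∈ cells M)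
    (h : Within (j + 1) Q₀ Q) : ∃ Q₁ ∈ cells M, Within j Q₀ Q₁ ∧ Near Q₁ Q := by
  simp only [cells, Finset.mem_product, Finset.mem_range] at h₀ hQ
  -- move each coordinate of `Q` one step towards `Q₀`
  have coord : ∀ a c : ℕ, a < M → c < M → a ≤ c + (j + 1) ∧ c ≤ a + (j + 1) →
      ∃ d < M, (a ≤ d + j ∧ d ≤ a + j) ∧ (d ≤ c + 1 ∧ c ≤ d + 1) := by
    intro a c ha hc h
    rcases lt_trichotomy a c with h1 | h1 | h1
    · exact ⟨c - 1, by omega, by omega, by omega⟩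
    · exact ⟨c, by omega, by omega, by omega⟩
    · exact ⟨c + 1, by omega, by omega, by omega⟩
  obtain ⟨d, hd, hd1, hd2⟩ := coord _ _ h₀.1 hQ.1 h.1
  obtain ⟨e, he, he1, he2⟩ := coord _ _ h₀.2 hQ.2 h.2
  exact ⟨(d, e), by simp [cells, hd, he], ⟨hd1, he1⟩, ⟨hd2, he2⟩⟩

section Phases

variable {V X : Type*} [Fintype V] [Fintype X] {w : X → X → ℝ} {M b : ℕ} {γ : ℝ}

/-- The cell `Q` contains at least `b ^ 2` informed nodes. -/
def Tiling.Saturated (T : Tiling X w M b γ) (z : (V → X) × Set V) (Q : ℕ × ℕ) : Prop :=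
  b ^ 2 ≤ (T.inCell z.1 z.2 Q).card

/-- The states in which all cells within distance `j` of some cell are saturated. -/
def Tiling.ballSaturated (T : Tiling X w M b γ) (j : ℕ) : Set ((V → X) × Set V) :=
  {z | ∃ Q₀ ∈ cells M, ∀ Q ∈ cells M, Within j Q₀ Q → T.Saturated z Q}

/-- The largest number of informed nodes in a cell. -/
noncomputable def Tiling.peak (T : Tiling X w M b γ) (z : (V → X) × Set V) : ℕ :=
  (cells M).sup fun Q => (T.inCell z.1 z.2 Q).card

theorem Tiling.card_le_peak (T : Tiling X w M b γ) (z : (V → X) × Set V) {Q : ℕ × ℕ}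
    (hQ : Q ∈ cells M) : (T.inCell z.1 z.2 Q).card ≤ T.peak z :=
  Finset.le_sup (f := fun Q => (T.inCell z.1 z.2 Q).card) hQ

theorem Tiling.exists_card_eq_peak (T : Tiling X w M b γ) (z : (V → X) × Set V)
    (h : 0 < T.peak z) : ∃ Q ∈ cells M, (T.inCell z.1 z.2 Q).card = T.peak z := by
  have hne : (cells M).Nonempty := by
    by_contra hc
    rw [Finset.not_nonempty_iff_eq_empty] at hc
    simp [Tiling.peak, hc] at h
  obtain ⟨Q, hQ, he⟩ := Finset.exists_mem_eq_sup (cells M) hne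
    fun Q => (T.inCell z.1 z.2 Q).card
  exact ⟨Q, hQ, he.symm⟩

theorem Tiling.saturated_of_ballSaturated (T : Tiling X w M b γ) {j : ℕ} (hj : M ≤ j)
    {z : (V → X) × Set V} (h : z ∈ T.ballSaturated j) {Q : ℕ × ℕ} (hQ : Q ∈ cells M) :
    T.Saturated z Q := by
  obtain ⟨Q₀, h₀, h⟩ := h
  refine h Q hQ ?_
  simp only [cells, Finset.mem_product, Finset.mem_range] at h₀ hQ
  unfold Within
  omega

/-- A potential that decreases by a constant factor in expectation while no cell is saturated. It
is comparable to the inverse of the largest number of informed nodes in a cell. -/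
noncomputable def Tiling.potential (T : Tiling X w M b γ) (K : ℕ) (z : (V → X) × Set V) : ℝ :=
  if b ^ 2 ≤ T.peak z then 0 else if T.peak z ≤ K then 1 else K / T.peak z

theorem Tiling.potential_le_one (T : Tiling X w M b γ) (K : ℕ) (z : (V → X) × Set V) :
    T.potential K z ≤ 1 := by
  unfold Tiling.potential
  split_ifs with h1 h2
  · norm_num
  · exact le_rfl
  · have : (K : ℝ) ≤ T.peak z := by exact_mod_cast (not_le.1 h2).le
    exact div_le_one_of_le₀ this (Nat.cast_nonneg _)

theorem Tiling.potential_nonneg (T : Tiling X w M b γ) (K : ℕ) (z : (V → X) × Set V) :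
    0 ≤ T.potential K z := by
  unfold Tiling.potential
  split_ifs <;> positivity

theorem Tiling.potential_le_div (T : Tiling X w M b γ) {K k : ℕ} {z : (V → X) × Set V}
    (hK : K ≤ k) (hk : k < T.peak z) : T.potential K z ≤ K / k := by
  unfold Tiling.potential
  split_ifs with h1 h2
  · positivity
  · omega
  · rcases Nat.eq_zero_or_pos k with rfl | h0
    · obtain rfl : K = 0 := by omega
      simp
    · gcongr

theorem Tiling.indicator_compl_ballSaturated_le (T : Tiling X w M b γ) {K : ℕ} (hK : 1 ≤ K)
    (hb : 1 ≤ b) (z : (V → X) × Set V) :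
    (T.ballSaturated 0)ᶜ.indicator 1 z ≤ (b : ℝ) ^ 2 * T.potential K z := by
  have hb1 : (1 : ℝ) ≤ (b : ℝ) ^ 2 := by exact_mod_cast Nat.one_le_pow _ _ hb
  by_cases hz : z ∈ T.ballSaturated 0
  · rw [Set.indicator_of_notMem (by simpa using hz)]
    exact mul_nonneg (by positivity) (T.potential_nonneg K z)
  · rw [Set.indicator_of_mem hz, Pi.one_apply]
    have h1 : ¬ b ^ 2 ≤ T.peak z := by
      intro h
      obtain ⟨Q, hQ, he⟩ := T.exists_card_eq_peak z ((Nat.one_le_pow _ _ hb).trans h)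
      refine hz ⟨Q, hQ, fun Q' hQ' hw => ?_⟩
      obtain rfl : Q' = Q := by
        unfold Within at hw
        ext <;> omega
      unfold Tiling.Saturated
      rwa [he]
    unfold Tiling.potential
    rw [if_neg h1]
    split_ifs with h2
    · linarith
    · have h3 : (T.peak z : ℝ) ≤ (b : ℝ) ^ 2 := by exact_mod_cast (not_le.1 h1).le
      have h4 : (0 : ℝ) < T.peak z := by exact_mod_cast (by omega : 0 < T.peak z)
      have h5 : (1 : ℝ) ≤ K := by exact_mod_cast hK
      rw [mul_div_assoc', le_div_iff₀ h4]
      nlinarith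

variable [DecidableEq V] {step : Set V → (V → X) → Set V}

/-- A saturated cell saturates each adjacent cell and remains saturated, up to an event of
exponentially small probability. -/
theorem Tiling.prodExp_not_saturated_le (T : Tiling X w M b γ) (hstep : Transmits T.tile step)
    (hw0 : ∀ x y, 0 ≤ w x y) (hw : ∀ x, ∑ y, w x y = 1) (hγ : 0 < γ) (hγ1 : γ ≤ 1) (hb : 2 ≤ b)
    {θ : ℝ} (hθ : 48 / γ ^ 2 ≤ θ) {z : (V → X) × Set V} (hz : T.Dense (θ + 1) z.1)
    {Q Q' : ℕ × ℕ} (hQ' : Q' ∈ cells M) (hQQ' : Near Q Q') (hsat : T.Saturated z Q) :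
    prodExp (fun i => w (z.1 i)) ({q | ¬ T.Saturated (q, step z.2 q) Q'}.indicator 1) ≤
      2 * Real.exp (-(γ * b ^ 2 / 8)) := by
  obtain ⟨A, hAs, hAc⟩ := Finset.exists_subset_card_eq hsat
  have := T.prodExp_double_le hstep hw0 hw hγ hγ1 hb hz hθ z.2 hQ' A
    (fun i hi => ⟨(T.mem_inCell.1 (hAs hi)).1, by
      rw [(T.mem_inCell.1 (hAs hi)).2]; exact hQQ'⟩) hAc.le
  rw [hAc] at this
  push_cast at this
  refine le_trans (prodExp_mono (fun _ _ => hw0 _ _) fun q => ?_) this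
  refine Set.indicator_le_indicator_of_subset (fun q hq => ?_) (fun _ => by simp) q
  simp only [Tiling.Saturated, Set.mem_ofPred_eq] at hq ⊢
  omega

/-- Drift of the potential: from few informed nodes the initial spreading step has a constant
chance, from many the doubling step fails with probability much smaller than the potential. -/
theorem Tiling.floodOp_potential_le (T : Tiling X w M b γ) (hstep : Transmits T.tile step)
    (hw0 : ∀ x y, 0 ≤ w x y) (hw : ∀ x, ∑ y, w x y = 1) (hγ : 0 < γ) (hγ1 : γ ≤ 1) (hb : 2 ≤ b)
    {θ : ℝ} (hθ : 48 / γ ^ 2 ≤ θ) {K : ℕ} (hK : 64 / γ ≤ K)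
    (hθK : 2 * ((2 * K : ℕ) + 8 / γ) / γ ≤ θ) {s : V} {z : (V → X) × Set V} (hs : s ∈ z.2) :
    floodOp w step (T.potential K) z ≤ (1 - γ / 16) * T.potential K z +
      2 * Real.exp (-(γ * b ^ 2 / 8)) + {p | ¬ T.Dense (θ + 1) p}.indicator 1 z.1 := by
  have hexp : 0 ≤ 2 * Real.exp (-(γ * b ^ 2 / 8)) := by positivity
  have hpot := T.potential_nonneg K z
  have hK0 : (64 : ℝ) ≤ K := le_trans (by rw [le_div_iff₀ hγ]; linarith) hK
  have hK1 : 64 ≤ K := by exact_mod_cast hK0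
  have hmono : ∀ {φ ψ : (V → X) → ℝ}, (∀ q, φ q ≤ ψ q) →
      prodExp (fun i => w (z.1 i)) φ ≤ prodExp (fun i => w (z.1 i)) ψ :=
    fun h => prodExp_mono (fun _ _ => hw0 _ _) h
  by_cases hz : T.Dense (θ + 1) z.1
  swap
  · rw [Set.indicator_of_mem hz, Pi.one_apply]
    have : floodOp w step (T.potential K) z ≤ 1 :=
      (hmono fun q => T.potential_le_one K _).trans (prodExp_const (fun _ => hw _) 1).le
    nlinarith
  rw [Set.indicator_of_notMem (by simpa using hz), add_zero]
  by_cases h1 : b ^ 2 ≤ T.peak z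
  · obtain ⟨Q, hQ, he⟩ := T.exists_card_eq_peak z (lt_of_lt_of_le (by positivity) h1)
    have := T.prodExp_not_saturated_le hstep hw0 hw hγ hγ1 hb hθ hz hQ (Near.refl Q)
      (by unfold Tiling.Saturated; rwa [he])
    refine (le_trans (hmono fun q => ?_) this).trans (by nlinarith)
    by_cases hq : T.Saturated (q, step z.2 q) Q
    · rw [Set.indicator_of_notMem (by simpa using hq)]
      unfold Tiling.potential
      rw [if_pos (le_trans hq (T.card_le_peak (q, step z.2 q) hQ))]
    · rw [Set.indicator_of_mem hq]
      exact T.potential_le_one K _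
  by_cases h2 : T.peak z ≤ K
  · have hval : T.potential K z = 1 := by simp [Tiling.potential, h1, h2]
    have := T.prodExp_start_le hstep hw0 hw hγ hγ1 hb hz (2 * K) hθK z.2 hs
    set E : Set (V → X) := {q | (T.inCell q (step z.2 q) (T.cell (z.1 s))).card ≤ 2 * K} with hE
    have hle : floodOp w step (T.potential K) z ≤
        prodExp (fun i => w (z.1 i)) (fun q => 1 / 2 + 1 / 2 * E.indicator 1 q) := by
      refine hmono fun q => ?_
      by_cases hq : q ∈ E
      · rw [Set.indicator_of_mem hq, Pi.one_apply]
        linarith [T.potential_le_one K (q, step z.2 q)]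
      · rw [Set.indicator_of_notMem hq, mul_zero, add_zero]
        have h3 : 2 * K < T.peak (q, step z.2 q) :=
          lt_of_lt_of_le (not_le.1 hq) (T.card_le_peak (q, step z.2 q) (T.cell_mem _))
        refine (T.potential_le_div (by omega) h3).trans ?_
        push_cast
        rw [div_le_div_iff₀ (by positivity) (by norm_num)]
        linarith
    rw [prodExp_add, prodExp_const_mul, prodExp_const (fun _ => hw _)] at hle
    rw [hval]
    linarith
  · set k := T.peak z with hk
    obtain ⟨Q, hQ, he⟩ := T.exists_card_eq_peak z (by omega)
    have hk0 : (0 : ℝ) < k := by exact_mod_cast (by omega : 0 < k)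
    have hval : T.potential K z = K / k := by simp [Tiling.potential, ← hk, h1, h2]
    have := T.prodExp_double_le hstep hw0 hw hγ hγ1 hb hz hθ z.2 hQ (T.inCell z.1 z.2 Q)
      (fun i hi => ⟨(T.mem_inCell.1 hi).1, by
        rw [(T.mem_inCell.1 hi).2]; exact Near.refl Q⟩) (by omega)
    rw [he, ← hk] at this
    set E : Set (V → X) := {q | (T.inCell q (step z.2 q) Q).card ≤ 2 * k} with hE
    have hle : floodOp w step (T.potential K) z ≤
        prodExp (fun i => w (z.1 i)) (fun q => K / (2 * k) + E.indicator 1 q) := by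
      refine hmono fun q => ?_
      by_cases hq : q ∈ E
      · rw [Set.indicator_of_mem hq, Pi.one_apply]
        have : (0 : ℝ) ≤ K / (2 * k) := by positivity
        linarith [T.potential_le_one K (q, step z.2 q)]
      · rw [Set.indicator_of_notMem hq, add_zero]
        have h3 : 2 * k < T.peak (q, step z.2 q) :=
          lt_of_lt_of_le (not_le.1 hq) (T.card_le_peak (q, step z.2 q) hQ)
        have := T.potential_le_div (K := K) (by omega) h3
        push_cast at this
        exact this
    rw [prodExp_add, prodExp_const (fun _ => hw _)] at hle
    have hsmall : 2 * Real.exp (-(γ * k / 8)) ≤ K / k / 4 := by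
      -- `exp (-x) ≤ 1 / x` with `x = γ k / 8`
      have h3 : Real.exp (-(γ * k / 8)) ≤ 8 / (γ * k) := by
        rw [Real.exp_neg, ← inv_div (γ * k) 8]
        refine inv_anti₀ (by positivity) ?_
        linarith [Real.add_one_le_exp (γ * k / 8)]
      have h4 : 2 * (8 / (γ * k)) = 64 / γ / k / 4 := by field_simp; norm_num
      calc 2 * Real.exp (-(γ * k / 8)) ≤ 2 * (8 / (γ * k)) := by linarith
        _ = 64 / γ / k / 4 := h4
        _ ≤ _ := by gcongr
    have h5 : (K : ℝ) / (2 * k) = K / k / 2 := by field_simp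
    rw [hval] at hpot ⊢
    rw [h5] at hle
    nlinarith

/-- The saturated ball grows by one cell in each direction per step. -/
theorem Tiling.floodOp_ballSaturated_le (T : Tiling X w M b γ) (hstep : Transmits T.tile step)
    (hw0 : ∀ x y, 0 ≤ w x y) (hw : ∀ x, ∑ y, w x y = 1) (hγ : 0 < γ) (hγ1 : γ ≤ 1) (hb : 2 ≤ b)
    {θ : ℝ} (hθ : 48 / γ ^ 2 ≤ θ) (j : ℕ) (z : (V → X) × Set V) :
    floodOp w step ((T.ballSaturated (j + 1))ᶜ.indicator 1) z ≤
      (T.ballSaturated j)ᶜ.indicator 1 z + (M : ℝ) ^ 2 * (2 * Real.exp (-(γ * b ^ 2 / 8))) +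
        {p | ¬ T.Dense (θ + 1) p}.indicator 1 z.1 := by
  classical
  have hexp : 0 ≤ (M : ℝ) ^ 2 * (2 * Real.exp (-(γ * b ^ 2 / 8))) := by positivity
  have hone : floodOp w step ((T.ballSaturated (j + 1))ᶜ.indicator 1) z ≤ 1 :=
    (prodExp_mono (fun _ _ => hw0 _ _) fun q => indicator_one_le _ _).trans
      (prodExp_const (fun _ => hw _) 1).le
  have hn1 := indicator_one_nonneg (T.ballSaturated j)ᶜ z
  have hn2 := indicator_one_nonneg {p | ¬ T.Dense (θ + 1) p} z.1
  by_cases hz : T.Dense (θ + 1) z.1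
  swap
  · rw [Set.indicator_of_mem (s := {p | ¬ T.Dense (θ + 1) p}) hz, Pi.one_apply]
    linarith
  by_cases hball : z ∈ T.ballSaturated j
  swap
  · rw [Set.indicator_of_mem (s := (T.ballSaturated j)ᶜ) hball, Pi.one_apply]
    linarith
  obtain ⟨Q₀, h₀, hsat⟩ := hball
  set F := (cells M).filter fun Q => Within (j + 1) Q₀ Q with hF
  have hle : floodOp w step ((T.ballSaturated (j + 1))ᶜ.indicator 1) z ≤
      ∑ Q ∈ F, prodExp (fun i => w (z.1 i))
        ({q | ¬ T.Saturated (q, step z.2 q) Q}.indicator 1) := by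
    rw [← prodExp_sum]
    refine prodExp_mono (fun _ _ => hw0 _ _) fun q => ?_
    by_cases hq : (q, step z.2 q) ∈ T.ballSaturated (j + 1)
    · rw [Set.indicator_of_notMem (by simpa using hq)]
      exact Finset.sum_nonneg fun Q _ => indicator_one_nonneg _ _
    · rw [Set.indicator_of_mem hq, Pi.one_apply]
      have : ∃ Q ∈ F, ¬ T.Saturated (q, step z.2 q) Q := by
        by_contra hc
        push Not at hc
        exact hq ⟨Q₀, h₀, fun Q hQ hw => hc Q (Finset.mem_filter.2 ⟨hQ, hw⟩)⟩
      obtain ⟨Q, hQF, hQ⟩ := this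
      refine le_trans ?_ (Finset.single_le_sum (fun Q _ => indicator_one_nonneg _ _) hQF)
      rw [Set.indicator_of_mem hQ, Pi.one_apply]
  have hcard : (F.card : ℝ) ≤ (M : ℝ) ^ 2 := by
    have : F.card ≤ M ^ 2 := (Finset.card_filter_le _ _).trans (by simp [cells, sq])
    exact_mod_cast this
  have hsum : ∑ Q ∈ F, prodExp (fun i => w (z.1 i))
      ({q | ¬ T.Saturated (q, step z.2 q) Q}.indicator 1) ≤
      F.card * (2 * Real.exp (-(γ * b ^ 2 / 8))) := by
    rw [← nsmul_eq_mul]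
    refine Finset.sum_le_card_nsmul _ _ _ fun Q hQ => ?_
    obtain ⟨hQ1, hQ2⟩ := Finset.mem_filter.1 hQ
    obtain ⟨Q₁, hQ₁, hw1, hnear⟩ := exists_within_near h₀ hQ1 hQ2
    exact T.prodExp_not_saturated_le hstep hw0 hw hγ hγ1 hb hθ hz hQ1 hnear (hsat Q₁ hQ₁ hw1)
  have : (F.card : ℝ) * (2 * Real.exp (-(γ * b ^ 2 / 8))) ≤
      (M : ℝ) ^ 2 * (2 * Real.exp (-(γ * b ^ 2 / 8))) := by gcongr
  linarith

/-- The number of uninformed nodes. -/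
noncomputable def uninformed (z : (V → X) × Set V) : ℝ := ∑ v, {v | v ∉ z.2}.indicator 1 v

/-- While all cells are saturated, the number of uninformed nodes decreases by a constant factor in
expectation. -/
theorem Tiling.floodOp_uninformed_le (T : Tiling X w M b γ) (hstep : Transmits T.tile step)
    (hw0 : ∀ x y, 0 ≤ w x y) (hw : ∀ x, ∑ y, w x y = 1) (hγ : 0 < γ) (hγ1 : γ ≤ 1) (hb : 2 ≤ b)
    (hbγ : Real.exp (-(γ * b ^ 2 / 8)) ≤ γ ^ 2 / 32) {j : ℕ} (hj : M ≤ j)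
    (z : (V → X) × Set V) :
    floodOp w step uninformed z ≤ (1 - γ ^ 2 / 32) * uninformed z +
      Fintype.card V * (T.ballSaturated j)ᶜ.indicator 1 z := by
  have hγ2 : 0 ≤ 1 - γ ^ 2 / 32 := by nlinarith
  have hu : ∀ z : (V → X) × Set V, 0 ≤ uninformed z := fun z =>
    Finset.sum_nonneg fun v _ => indicator_one_nonneg _ _
  by_cases hz : z ∈ T.ballSaturated j
  · rw [Set.indicator_of_notMem (by simpa using hz), mul_zero, add_zero]
    unfold floodOp uninformed
    rw [prodExp_sum, Finset.mul_sum]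
    refine Finset.sum_le_sum fun v _ => ?_
    by_cases hv : v ∈ z.2
    · rw [Set.indicator_of_notMem (by simpa using hv), mul_zero,
        ← prodExp_const (w := fun i => w (z.1 i)) (fun _ => hw _) 0]
      refine prodExp_mono (fun _ _ => hw0 _ _) fun q => ?_
      rw [Set.indicator_of_notMem (by simpa using hstep.subset z.2 q hv)]
    · rw [Set.indicator_of_mem hv, Pi.one_apply, mul_one]
      exact T.prodExp_notMem_le hstep hw0 hw hγ hγ1 hb hbγ z.2 hv
        (T.saturated_of_ballSaturated hj hz (T.cell_mem _))
  · rw [Set.indicator_of_mem hz, Pi.one_apply, mul_one]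
    have : floodOp w step uninformed z ≤ Fintype.card V := by
      refine (prodExp_mono (fun _ _ => hw0 _ _) fun q => ?_).trans
        (prodExp_const (fun _ => hw _) (Fintype.card V : ℝ)).le
      refine (Finset.sum_le_sum fun v _ => indicator_one_le _ _).trans ?_
      simp
    have := mul_nonneg hγ2 (hu z)
    linarith

/-- The expected number of uninformed nodes after `t₁` steps for saturating a first cell, `M` steps
for saturating all cells, and `t₃` steps for informing the remaining nodes. Here `d` bounds the
failure probability of a spreading step, and `e` the probability of a configuration that is not
dense. -/
theorem Tiling.floodExp_uninformed_le (T : Tiling X w M b γ) (hstep : Transmits T.tile step)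
    (hw0 : ∀ x y, 0 ≤ w x y) (hw : ∀ x, ∑ y, w x y = 1) (hγ : 0 < γ) (hγ1 : γ ≤ 1) (hb : 2 ≤ b)
    (hbγ : Real.exp (-(γ * b ^ 2 / 8)) ≤ γ ^ 2 / 32) {θ : ℝ} (hθ : 48 / γ ^ 2 ≤ θ) {K : ℕ}
    (hK : 64 / γ ≤ K) (hθK : 2 * ((2 * K : ℕ) + 8 / γ) / γ ≤ θ) {π : X → ℝ} (hπ0 : ∀ x, 0 ≤ π x)
    (hπ : ∑ x, π x = 1) (hstat : ∀ y, ∑ x, π x * w x y = π y) (s : V) {d e : ℝ}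
    (hd : 2 * Real.exp (-(γ * b ^ 2 / 8)) ≤ d)
    (he : prodExp (fun _ : V => π) ({p | ¬ T.Dense (θ + 1) p}.indicator 1) ≤ e) (t₁ t₃ : ℕ) :
    floodExp w step π s (t₁ + M + t₃) uninformed ≤
      (1 - γ ^ 2 / 32) ^ t₃ * Fintype.card V + t₃ * (Fintype.card V *
        ((b : ℝ) ^ 2 * ((1 - γ / 16) ^ t₁ + t₁ * (d + e)) + (M + t₃) * ((M : ℝ) ^ 2 * d + e))) := by
  have hd0 : 0 ≤ d := le_trans (by positivity) hd
  have he0 : 0 ≤ e := le_trans (by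
    rw [← prodExp_const (w := fun _ : V => π) (fun _ => hπ) 0]
    exact prodExp_mono (fun _ => hπ0) fun q => indicator_one_nonneg _ _) he
  have hmono : ∀ {f g : (V → X) × Set V → ℝ}, (∀ z, s ∈ z.2 → f z ≤ g z) → ∀ t,
      floodExp w step π s t f ≤ floodExp w step π s t g :=
    fun h => floodExp_mono hw0 hπ0 hstep.subset h
  have hbad : ∀ t, floodExp w step π s t
      (fun z => {p | ¬ T.Dense (θ + 1) p}.indicator 1 z.1) ≤ e :=
    fun t => (floodExp_fst hstat t _).trans_le he
  have hconst : ∀ t c, floodExp w step π s t (fun _ => c) = c := floodExp_const hw hπ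
  have hγ16 : 0 ≤ 1 - γ / 16 := by linarith
  have hγ32 : 0 ≤ 1 - γ ^ 2 / 32 := by nlinarith
  have phase1 : ∀ t : ℕ, floodExp w step π s t (T.potential K) ≤
      (1 - γ / 16) ^ t + t * (d + e) := by
    intro t
    induction t with
    | zero =>
      have := hmono (fun z _ => T.potential_le_one K z) 0
      rw [hconst] at this
      simpa using this
    | succ t ih =>
      rw [floodExp_succ]
      refine (hmono (fun z hz =>
        T.floodOp_potential_le hstep hw0 hw hγ hγ1 hb hθ hK hθK hz) t).trans ?_
      rw [floodExp_add, floodExp_add, floodExp_const_mul, hconst]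
      have h1 := hbad t
      have h2 : (1 - γ / 16) * floodExp w step π s t (T.potential K) ≤
          (1 - γ / 16) * ((1 - γ / 16) ^ t + t * (d + e)) := by gcongr
      have h3 : (1 - γ / 16) * (t * (d + e)) ≤ t * (d + e) :=
        mul_le_of_le_one_left (by positivity) (by linarith)
      rw [pow_succ' (1 - γ / 16)]
      push_cast
      linarith
  have phase2 : ∀ j : ℕ, floodExp w step π s (t₁ + j) ((T.ballSaturated j)ᶜ.indicator 1) ≤
      (b : ℝ) ^ 2 * ((1 - γ / 16) ^ t₁ + t₁ * (d + e)) + j * ((M : ℝ) ^ 2 * d + e) := by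
    intro j
    induction j with
    | zero =>
      have hK1 : 1 ≤ K := by
        have : (0 : ℝ) < K := lt_of_lt_of_le (by positivity) hK
        exact_mod_cast this
      refine (hmono (fun z _ =>
        T.indicator_compl_ballSaturated_le hK1 (by omega) z) _).trans ?_
      rw [floodExp_const_mul]
      simp only [add_zero, Nat.cast_zero, zero_mul]
      have := phase1 t₁
      gcongr
    | succ j ih =>
      rw [← add_assoc, floodExp_succ]
      refine (hmono (fun z _ =>
        T.floodOp_ballSaturated_le hstep hw0 hw hγ hγ1 hb hθ j z) _).trans ?_
      rw [floodExp_add, floodExp_add, hconst]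
      have h1 := hbad (t₁ + j)
      have h2 : (M : ℝ) ^ 2 * (2 * Real.exp (-(γ * b ^ 2 / 8))) ≤ (M : ℝ) ^ 2 * d := by gcongr
      push_cast
      linarith
  set n : ℝ := (Fintype.card V : ℝ) with hn
  have hn0 : 0 ≤ n := Nat.cast_nonneg _
  have phase3 : ∀ t : ℕ, floodExp w step π s (t₁ + M + t) uninformed ≤
      (1 - γ ^ 2 / 32) ^ t * n + t * (n * ((b : ℝ) ^ 2 * ((1 - γ / 16) ^ t₁ + t₁ * (d + e)) +
        (M + t) * ((M : ℝ) ^ 2 * d + e))) := by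
    intro t
    induction t with
    | zero =>
      have : ∀ z : (V → X) × Set V, uninformed z ≤ n := fun z =>
        (Finset.sum_le_sum fun v _ => indicator_one_le _ _).trans (by simp [hn])
      have := hmono (fun z _ => this z) (t₁ + M + 0)
      rw [hconst] at this
      simpa using this
    | succ t ih =>
      rw [← add_assoc, floodExp_succ]
      refine (hmono (fun z _ => T.floodOp_uninformed_le hstep hw0 hw hγ hγ1 hb hbγ
        (Nat.le_add_right M t) z) _).trans ?_
      rw [floodExp_add, floodExp_const_mul, floodExp_const_mul]
      have h1 := phase2 (M + t)
      rw [← add_assoc, ← hn] at *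
      push_cast at h1 ⊢
      set R := (b : ℝ) ^ 2 * ((1 - γ / 16) ^ t₁ + t₁ * (d + e)) +
        (M + t) * ((M : ℝ) ^ 2 * d + e) with hR
      have hR0 : 0 ≤ R := by positivity
      have hR' : R ≤ (b : ℝ) ^ 2 * ((1 - γ / 16) ^ t₁ + t₁ * (d + e)) +
          (M + (t + 1)) * ((M : ℝ) ^ 2 * d + e) := by
        have : 0 ≤ (M : ℝ) ^ 2 * d + e := by positivity
        rw [hR]
        nlinarith
      have h2 := mul_le_mul_of_nonneg_left ih hγ32
      have h3 : (1 - γ ^ 2 / 32) * (t * (n * R)) ≤ t * (n * R) :=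
        mul_le_of_le_one_left (by positivity) (by nlinarith)
      have h4 := mul_le_mul_of_nonneg_left h1 hn0
      have h5 : (t + 1) * (n * R) ≤ (t + 1) * (n * ((b : ℝ) ^ 2 *
          ((1 - γ / 16) ^ t₁ + t₁ * (d + e)) + (M + (t + 1)) * ((M : ℝ) ^ 2 * d + e))) := by
        gcongr
      rw [pow_succ' (1 - γ ^ 2 / 32)]
      linarith
  exact phase3 t₃

end Phases

/-! ### The geometry of the grid -/

section Geometry

variable {n : ℕ} {ρ ε : ℝ} {u b : ℕ}

theorem sq_dist_point (x y : Grid n ε) :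
    dist (point x) (point y) ^ 2 =
      (((x.1 : ℝ) - y.1) * ε) ^ 2 + (((x.2 : ℝ) - y.2) * ε) ^ 2 := by
  rw [EuclideanSpace.dist_eq, Real.sq_sqrt (Finset.sum_nonneg fun _ _ => sq_nonneg _),
    Fin.sum_univ_two]
  simp only [point, Real.dist_eq, sq_abs]
  simp
  ring

theorem dist_point_le {x y : Grid n ε} {k : ℕ} (hε : 0 < ε)
    (h1 : (x.1 : ℕ) ≤ y.1 + k ∧ (y.1 : ℕ) ≤ x.1 + k)
    (h2 : (x.2 : ℕ) ≤ y.2 + k ∧ (y.2 : ℕ) ≤ x.2 + k) :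
    dist (point x) (point y) ≤ 2 * (k * ε) := by
  have coord : ∀ a c : ℕ, a ≤ c + k ∧ c ≤ a + k → (((a : ℝ) - c) * ε) ^ 2 ≤ (k * ε) ^ 2 := by
    intro a c h
    have h3 : (a : ℝ) ≤ c + k := by exact_mod_cast h.1
    have h4 : (c : ℝ) ≤ a + k := by exact_mod_cast h.2
    refine sq_le_sq' ?_ ?_ <;> nlinarith
  refine le_of_sq_le_sq ?_ (by positivity)
  rw [sq_dist_point]
  have h5 := coord _ _ h1
  have h6 := coord _ _ h2
  nlinarith [sq_nonneg ((k : ℝ) * ε)]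

theorem le_add_floor_of_dist_le {x y : Grid n ε} (hε : 0 < ε)
    (h : dist (point x) (point y) ≤ ρ) :
    ((x.1 : ℕ) ≤ y.1 + ⌊ρ / ε⌋₊ ∧ (y.1 : ℕ) ≤ x.1 + ⌊ρ / ε⌋₊) ∧
      ((x.2 : ℕ) ≤ y.2 + ⌊ρ / ε⌋₊ ∧ (y.2 : ℕ) ≤ x.2 + ⌊ρ / ε⌋₊) := by
  have hsq : dist (point x) (point y) ^ 2 ≤ ρ ^ 2 := pow_le_pow_left₀ dist_nonneg h 2
  have hρ : 0 ≤ ρ := dist_nonneg.trans h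
  rw [sq_dist_point] at hsq
  have coord : ∀ a c : ℕ, (((a : ℝ) - c) * ε) ^ 2 ≤ ρ ^ 2 → a ≤ c + ⌊ρ / ε⌋₊ := by
    intro a c h
    have h1 : ((a : ℝ) - c) * ε ≤ ρ := le_of_sq_le_sq h hρ
    rw [← Nat.sub_le_iff_le_add']
    refine Nat.le_floor ?_
    rw [le_div_iff₀ hε]
    rcases le_total c a with hca | hca
    · rwa [Nat.cast_sub hca]
    · simpa [Nat.sub_eq_zero_of_le hca] using hρ
  have e1 := sq_nonneg (((x.1 : ℝ) - y.1) * ε)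
  have e2 := sq_nonneg (((x.2 : ℝ) - y.2) * ε)
  refine ⟨⟨coord _ _ (by linarith), coord _ _ ?_⟩, coord _ _ (by linarith), coord _ _ ?_⟩
  · rw [show (((y.1 : ℕ) : ℝ) - (x.1 : ℕ)) * ε = -(((x.1 : ℝ) - y.1) * ε) by ring, neg_sq]
    linarith
  · rw [show (((y.2 : ℕ) : ℝ) - (x.2 : ℕ)) * ε = -(((x.2 : ℝ) - y.2) * ε) by ring, neg_sq]
    linarith

theorem mem_moves {x y : Grid n ε} : y ∈ moves ρ x ↔ dist (point x) (point y) ≤ ρ := by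
  simp [moves]

/-- Tiles of `u × u` grid points and cells of `b × b` tiles are of the right size for the move
radius `ρ`: a cell has side between `ρ / 12` and `ρ / 6`. -/
structure Resolution (n : ℕ) (ρ ε : ℝ) (u b : ℕ) : Prop where
  eps_pos : 0 < ε
  u_pos : 0 < u
  b_pos : 0 < b
  le_rho : 6 * ((b * u : ℕ) * ε) ≤ ρ
  rho_le : ρ ≤ 12 * ((b * u : ℕ) * ε)
  rho_le_side : ρ ≤ √(n : ℝ)

/-- The number of cells per side. Points beyond the last full cell are added to the last cell. -/
noncomputable def cellCount (n : ℕ) (ε : ℝ) (u b : ℕ) : ℕ := (⌊√(n : ℝ) / ε⌋₊ + 1) / (b * u)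

/-- The core tiles of a cell: a `b × b` array. -/
def coreTiles (b : ℕ) (Q : ℕ × ℕ) : Finset (ℕ × ℕ) :=
  Finset.Ico (Q.1 * b) (Q.1 * b + b) ×ˢ Finset.Ico (Q.2 * b) (Q.2 * b + b)

/-- The tile of a grid point. -/
def tileOf (u : ℕ) (x : Grid n ε) : ℕ × ℕ := ((x.1 : ℕ) / u, (x.2 : ℕ) / u)

/-- The cell of a grid point. -/
noncomputable def cellOf (u b : ℕ) (x : Grid n ε) : ℕ × ℕ :=
  (min ((x.1 : ℕ) / (b * u)) (cellCount n ε u b - 1),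
    min ((x.2 : ℕ) / (b * u)) (cellCount n ε u b - 1))

theorem card_coreTiles (b : ℕ) (Q : ℕ × ℕ) : (coreTiles b Q).card = b ^ 2 := by
  simp [coreTiles, sq]

theorem cellOf_eq {Q : ℕ × ℕ} (hQ : Q ∈ cells (cellCount n ε u b))
    {x : Grid n ε} (h : tileOf u x ∈ coreTiles b Q) : cellOf u b x = Q := by
  simp only [coreTiles, tileOf, Finset.mem_product, Finset.mem_Ico] at h
  simp only [cells, Finset.mem_product, Finset.mem_range] at hQ
  have coord : ∀ a c : ℕ, c < cellCount n ε u b → c * b ≤ a / u ∧ a / u < c * b + b →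
      min (a / (b * u)) (cellCount n ε u b - 1) = c := by
    intro a c hc h
    have : a / (b * u) = c := by
      rw [mul_comm b u, ← Nat.div_div_eq_div_mul]
      exact Nat.div_eq_of_lt_le h.1 (by rw [Nat.succ_mul]; exact h.2)
    omega
  exact Prod.ext (coord _ _ hQ.1 h.1) (coord _ _ hQ.2 h.2)

namespace Resolution

theorem mul_pos (R : Resolution n ρ ε u b) : 0 < b * u := Nat.mul_pos R.b_pos R.u_pos

theorem one_le_mul_eps (R : Resolution n ρ ε u b) : ε ≤ (b * u : ℕ) * ε :=
  le_mul_of_one_le_left R.eps_pos.le (by exact_mod_cast R.mul_pos)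

theorem cellCount_pos (R : Resolution n ρ ε u b) : 0 < cellCount n ε u b := by
  refine Nat.div_pos ?_ R.mul_pos
  have h1 : ((b * u : ℕ) : ℝ) ≤ √(n : ℝ) / ε := by
    rw [le_div_iff₀ R.eps_pos]
    have := R.le_rho
    have := R.rho_le_side
    have := R.one_le_mul_eps
    have := R.eps_pos
    linarith
  exact (Nat.le_floor h1).trans (Nat.le_succ _)

theorem cellOf_mem (R : Resolution n ρ ε u b) (x : Grid n ε) :
    cellOf u b x ∈ cells (cellCount n ε u b) := by
  have := R.cellCount_pos
  simp only [cells, cellOf, Finset.mem_product, Finset.mem_range]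
  omega

/-- A point and the core of a cell equal or adjacent to its cell are within distance `ρ`. -/
theorem mem_moves_of_near (R : Resolution n ρ ε u b) {Q : ℕ × ℕ} {x y : Grid n ε}
    (hy : tileOf u y ∈ coreTiles b Q) (hn : Near (cellOf u b x) Q) : y ∈ moves ρ x := by
  rw [mem_moves]
  simp only [coreTiles, tileOf, Finset.mem_product, Finset.mem_Ico] at hy
  have coord : ∀ a d c : ℕ, d < ⌊√(n : ℝ) / ε⌋₊ + 1 → c * b ≤ a / u ∧ a / u < c * b + b →
      min (d / (b * u)) (cellCount n ε u b - 1) ≤ c + 1 ∧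
        c ≤ min (d / (b * u)) (cellCount n ε u b - 1) + 1 →
      d ≤ a + 3 * (b * u) ∧ a ≤ d + 3 * (b * u) := by
    intro a d c hd ha h
    have hM := R.cellCount_pos
    have hd1 : d / (b * u) ≤ cellCount n ε u b := Nat.div_le_div_right hd.le
    have hd2 : d < (d / (b * u) + 1) * (b * u) := by
      have := Nat.lt_div_mul_add (a := d) R.mul_pos
      rw [Nat.succ_mul]; exact this
    have hd3 : d / (b * u) * (b * u) ≤ d := Nat.div_mul_le_self _ _
    have ha1 : c * (b * u) ≤ a := by
      have := (Nat.le_div_iff_mul_le R.u_pos).1 ha.1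
      rwa [mul_assoc] at this
    have ha2 : a < (c + 1) * (b * u) := by
      have := (Nat.div_lt_iff_lt_mul R.u_pos).1 ha.2
      rwa [show c * b + b = (c + 1) * b by ring, mul_assoc] at this
    generalize b * u = k at *
    generalize d / k = e at *
    have h1 : e ≤ c + 2 := by omega
    have h2 : c ≤ e + 1 := by omega
    constructor
    · have := Nat.mul_le_mul_right k (by omega : e + 1 ≤ c + 3)
      rw [Nat.add_mul c 3] at this
      omega
    · have := Nat.mul_le_mul_right k (by omega : c + 1 ≤ e + 2)
      rw [Nat.add_mul e 2] at this
      omega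
  refine (dist_point_le R.eps_pos (k := 3 * (b * u)) (coord _ _ _ x.1.2 hy.1 hn.1)
    (coord _ _ _ x.2.2 hy.2 hn.2)).trans (le_trans (le_of_eq ?_) R.le_rho)
  push_cast
  ring

/-- A core tile consists of `u ^ 2` grid points. -/
theorem sq_le_card_tile (R : Resolution n ρ ε u b) {Q τ : ℕ × ℕ}
    (hQ : Q ∈ cells (cellCount n ε u b)) (hτ : τ ∈ coreTiles b Q) :
    u ^ 2 ≤ (Finset.univ.filter fun y : Grid n ε => tileOf u y = τ).card := by
  simp only [coreTiles, Finset.mem_product, Finset.mem_Ico] at hτ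
  simp only [cells, Finset.mem_product, Finset.mem_range] at hQ
  have coord : ∀ c t i : ℕ, c < cellCount n ε u b → t < c * b + b → i < u →
      t * u + i < ⌊√(n : ℝ) / ε⌋₊ + 1 := by
    intro c t i hc ht hi
    have h1 : cellCount n ε u b * (b * u) ≤ ⌊√(n : ℝ) / ε⌋₊ + 1 := Nat.div_mul_le_self _ _
    have h2 : (t + 1) * u ≤ (c + 1) * b * u := Nat.mul_le_mul_right u (by rw [Nat.succ_mul]; omega)
    have h3 : (c + 1) * (b * u) ≤ cellCount n ε u b * (b * u) := Nat.mul_le_mul_right _ hc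
    rw [mul_assoc] at h2
    rw [Nat.succ_mul t] at h2
    omega
  let f : Fin u × Fin u → Grid n ε := fun z =>
    (⟨τ.1 * u + z.1, coord _ _ _ hQ.1 hτ.1.2 z.1.2⟩,
      ⟨τ.2 * u + z.2, coord _ _ _ hQ.2 hτ.2.2 z.2.2⟩)
  have hdiv : ∀ t i : ℕ, i < u → (t * u + i) / u = t := by
    intro t i hi
    rw [mul_comm, Nat.mul_add_div R.u_pos, Nat.div_eq_of_lt hi, add_zero]
  have : (Finset.univ : Finset (Fin u × Fin u)).card ≤
      (Finset.univ.filter fun y : Grid n ε => tileOf u y = τ).card := by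
    refine Finset.card_le_card_of_injOn f (fun z _ => ?_) fun z _ z' _ h => ?_
    · rw [Finset.mem_coe, Finset.mem_filter]
      exact ⟨Finset.mem_univ _, Prod.ext (hdiv _ _ z.1.2) (hdiv _ _ z.2.2)⟩
    · have h1 := congrArg (fun y : Grid n ε => (y.1 : ℕ)) h
      have h2 := congrArg (fun y : Grid n ε => (y.2 : ℕ)) h
      simp only [f] at h1 h2
      exact Prod.ext (Fin.ext (by omega)) (Fin.ext (by omega))
  simpa [sq] using this

theorem sq_le_card_core (R : Resolution n ρ ε u b) {Q : ℕ × ℕ}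
    (hQ : Q ∈ cells (cellCount n ε u b)) :
    (b * u) ^ 2 ≤ (Finset.univ.filter fun y : Grid n ε => tileOf u y ∈ coreTiles b Q).card := by
  have hfib := Finset.card_eq_sum_card_fiberwise
    (s := Finset.univ.filter fun y : Grid n ε => tileOf u y ∈ coreTiles b Q) (f := tileOf u)
    (t := coreTiles b Q) (fun y hy => (Finset.mem_filter.1 (Finset.mem_coe.1 hy)).2)
  rw [hfib, mul_pow, ← card_coreTiles b Q, ← smul_eq_mul]
  refine Finset.card_nsmul_le_sum _ _ _ fun τ hτ => (R.sq_le_card_tile hQ hτ).trans ?_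
  refine Finset.card_le_card fun y hy => ?_
  have := (Finset.mem_filter.1 hy).2
  simp [this, hτ]

theorem card_moves_le (R : Resolution n ρ ε u b) (x : Grid n ε) :
    ((moves ρ x).card : ℝ) ≤ 1296 * ((b * u : ℕ) : ℝ) ^ 2 := by
  have hε := R.eps_pos
  set k := ⌊ρ / ε⌋₊ with hk
  have hρε : 1 ≤ ρ / ε := by
    rw [one_le_div hε]
    have := R.le_rho
    have := R.one_le_mul_eps
    linarith
  have h1 : (moves ρ x).card ≤ (2 * k + 1) ^ 2 := by
    have hI : ∀ a : ℕ, (Finset.Icc (a - k) (a + k)).card ≤ 2 * k + 1 := by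
      intro a
      rw [Nat.card_Icc]
      omega
    have : (moves ρ x).card ≤ (Finset.Icc ((x.1 : ℕ) - k) (x.1 + k) ×ˢ
        Finset.Icc ((x.2 : ℕ) - k) (x.2 + k)).card := by
      refine Finset.card_le_card_of_injOn (fun y => ((y.1 : ℕ), (y.2 : ℕ))) (fun y hy => ?_)
        fun y _ y' _ h => ?_
      · have := le_add_floor_of_dist_le hε (mem_moves.1 (Finset.mem_coe.1 hy))
        simp only [Finset.coe_product, Set.mem_prod, Finset.coe_Icc, Set.mem_Icc]
        omega
      · simp only [Prod.mk.injEq] at h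
        exact Prod.ext (Fin.ext h.1) (Fin.ext h.2)
    rw [Finset.card_product] at this
    exact this.trans (by rw [sq]; exact Nat.mul_le_mul (hI _) (hI _))
  have h2 : ((2 * k + 1 : ℕ) : ℝ) ≤ 36 * (b * u : ℕ) := by
    have h3 : (k : ℝ) ≤ ρ / ε := Nat.floor_le (by linarith)
    have h4 : ρ / ε ≤ 12 * (b * u : ℕ) := by
      rw [div_le_iff₀ hε]
      have := R.rho_le
      linarith
    push_cast at *
    linarith
  calc ((moves ρ x).card : ℝ) ≤ ((2 * k + 1 : ℕ) : ℝ) ^ 2 := by exact_mod_cast h1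
    _ ≤ (36 * (b * u : ℕ)) ^ 2 := by gcongr
    _ = _ := by ring

theorem sq_le_card_moves (R : Resolution n ρ ε u b) (x : Grid n ε) :
    (b * u) ^ 2 ≤ (moves ρ x).card :=
  (R.sq_le_card_core (R.cellOf_mem x)).trans (Finset.card_le_card fun _ hy =>
    R.mem_moves_of_near (Finset.mem_filter.1 hy).2 (Near.refl _))

theorem card_moves_pos (R : Resolution n ρ ε u b) (x : Grid n ε) :
    (0 : ℝ) < (moves ρ x).card := by
  have := R.mul_pos
  exact_mod_cast lt_of_lt_of_le (by positivity) (R.sq_le_card_moves x)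

/-- The tiling of the grid. The constant is `1 / 36 ^ 2` because `Γ(x)` has at most `36 ^ 2`
times as many points as the core of a cell. -/
noncomputable def tiling (R : Resolution n ρ ε u b) :
    Tiling (Grid n ε) (moveProb ρ) (cellCount n ε u b) b (1 / 1296) where
  cell := cellOf u b
  tile := tileOf u
  core := coreTiles b
  cell_mem := R.cellOf_mem
  card_core := card_coreTiles b
  cell_eq _ hQ _ h := cellOf_eq hQ h
  le_move x Q hQ hn τ hτ := by
    classical
    have h1 : ∀ y, moveProb ρ x y * {y | tileOf u y = τ}.indicator 1 y =
        if tileOf u y = τ then 1 / ((moves ρ x).card : ℝ) else 0 := by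
      intro y
      by_cases hy : tileOf u y = τ
      · have : y ∈ moves ρ x := R.mem_moves_of_near (hy ▸ hτ) hn
        simp [hy, moveProb, this]
      · simp [hy]
    rw [Finset.sum_congr rfl fun y _ => h1 y, ← Finset.sum_filter, Finset.sum_const, nsmul_eq_mul]
    have h2 : ((u : ℝ)) ^ 2 ≤
        (Finset.univ.filter fun y : Grid n ε => tileOf u y = τ).card := by
      exact_mod_cast R.sq_le_card_tile hQ hτ
    have h3 := R.card_moves_le x
    have h4 := R.card_moves_pos x
    have hb : (0 : ℝ) < b := by exact_mod_cast R.b_pos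
    rw [mul_one_div, div_div, div_le_div_iff₀ (by positivity) h4]
    push_cast at h3
    nlinarith [sq_nonneg (b : ℝ)]

end Resolution

/-! ### The stationary distribution -/

theorem moveProb_nonneg (x y : Grid n ε) : 0 ≤ moveProb ρ x y := by
  unfold moveProb
  split_ifs <;> positivity

theorem statProb_nonneg (x : Grid n ε) : 0 ≤ statProb ρ x := by
  unfold statProb
  positivity

namespace Resolution

theorem sum_moveProb (R : Resolution n ρ ε u b) (x : Grid n ε) : ∑ y, moveProb ρ x y = 1 := by
  classical
  unfold moveProb
  rw [← Finset.sum_filter, Finset.sum_const, Finset.filter_mem_eq_inter, Finset.univ_inter,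
    nsmul_eq_mul, mul_one_div_cancel (R.card_moves_pos x).ne']

theorem sum_card_moves_pos (R : Resolution n ρ ε u b) :
    (0 : ℝ) < ∑ y : Grid n ε, ((moves ρ y).card : ℝ) :=
  Finset.sum_pos (fun y _ => R.card_moves_pos y) ⟨(0, 0), Finset.mem_univ _⟩

theorem sum_statProb (R : Resolution n ρ ε u b) : ∑ x : Grid n ε, statProb ρ x = 1 := by
  unfold statProb
  rw [← Finset.sum_div, div_self R.sum_card_moves_pos.ne']

/-- The weights `|Γ(x)|` are reversible because `y ∈ Γ(x)` is a symmetric relation. -/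
theorem sum_statProb_mul_moveProb (R : Resolution n ρ ε u b) (y : Grid n ε) :
    ∑ x, statProb ρ x * moveProb ρ x y = statProb ρ y := by
  classical
  have h1 : ∀ x : Grid n ε, statProb ρ x * moveProb ρ x y =
      if x ∈ moves ρ y then 1 / ∑ z : Grid n ε, ((moves ρ z).card : ℝ) else 0 := by
    intro x
    have h2 : y ∈ moves ρ x ↔ x ∈ moves ρ y := by
      rw [mem_moves, mem_moves, dist_comm]
    have h3 := (R.card_moves_pos x).ne'
    unfold statProb moveProb
    rw [if_congr h2 rfl rfl, mul_ite, mul_zero, div_mul_div_comm, mul_one,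
      mul_comm _ ((moves ρ x).card : ℝ), ← div_div, div_self h3]
  rw [Finset.sum_congr rfl fun x _ => h1 x, ← Finset.sum_filter, Finset.sum_const,
    Finset.filter_mem_eq_inter, Finset.univ_inter, nsmul_eq_mul, mul_one_div]
  rfl

/-- The stationary mass of a cell is of the order of its share of the square. -/
theorem le_statProb_cell (R : Resolution n ρ ε u b) {Q : ℕ × ℕ}
    (hQ : Q ∈ cells (cellCount n ε u b)) :
    ((b * u : ℕ) * ε) ^ 2 / 5184 ≤
      n * ∑ x : Grid n ε, statProb ρ x * {x | cellOf u b x = Q}.indicator 1 x := by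
  classical
  have hε := R.eps_pos
  obtain ⟨N, hN⟩ : ∃ N, N = ⌊√(n : ℝ) / ε⌋₊ + 1 := ⟨_, rfl⟩
  set k : ℝ := ((b * u : ℕ) : ℝ) with hk
  have hk0 : 0 < k := by rw [hk]; exact_mod_cast R.mul_pos
  obtain ⟨Z, hZ⟩ : ∃ Z, Z = ∑ y : Grid n ε, ((moves ρ y).card : ℝ) := ⟨_, rfl⟩
  have hZ0 : 0 < Z := hZ ▸ R.sum_card_moves_pos
  have hN1 : (N : ℝ) * ε ≤ 2 * √(n : ℝ) := by
    have h1 : ε ≤ √(n : ℝ) := by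
      have := R.le_rho
      have := R.one_le_mul_eps
      have := R.rho_le_side
      linarith
    have h2 : (⌊√(n : ℝ) / ε⌋₊ : ℝ) ≤ √(n : ℝ) / ε := Nat.floor_le (by positivity)
    rw [le_div_iff₀ hε] at h2
    rw [hN]
    push_cast
    linarith
  have hNn : (N : ℝ) ^ 2 * ε ^ 2 ≤ 4 * n := by
    have h1 : ((N : ℝ) * ε) ^ 2 ≤ (2 * √(n : ℝ)) ^ 2 := pow_le_pow_left₀ (by positivity) hN1 2
    rw [mul_pow, mul_pow, Real.sq_sqrt (Nat.cast_nonneg n)] at h1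
    linarith
  have hZle : Z ≤ (N : ℝ) ^ 2 * (1296 * k ^ 2) := by
    have h1 : Z ≤ (Finset.univ : Finset (Grid n ε)).card • (1296 * k ^ 2) :=
      hZ ▸ Finset.sum_le_card_nsmul _ _ _ fun y _ => R.card_moves_le y
    rw [nsmul_eq_mul] at h1
    refine h1.trans (le_of_eq ?_)
    rw [Finset.card_univ, Fintype.card_prod, Fintype.card_fin, ← hN, sq (N : ℝ), Nat.cast_mul]
  have hmass : k ^ 2 * (k ^ 2 / Z) ≤
      ∑ x : Grid n ε, statProb ρ x * {x | cellOf u b x = Q}.indicator 1 x := by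
    obtain ⟨F, hF⟩ : ∃ F : Finset (Grid n ε),
        F = Finset.univ.filter fun y : Grid n ε => tileOf u y ∈ coreTiles b Q := ⟨_, rfl⟩
    have hFQ : ∀ x ∈ F, cellOf u b x = Q := fun x hx => by
      rw [hF] at hx
      exact cellOf_eq hQ (Finset.mem_filter.1 hx).2
    have h1 : k ^ 2 ≤ (F.card : ℝ) := by
      rw [hk, hF]
      exact_mod_cast R.sq_le_card_core hQ
    have h2 : ∀ x ∈ F, k ^ 2 / Z ≤ statProb ρ x * {x | cellOf u b x = Q}.indicator 1 x := by
      intro x hx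
      have hxm : x ∈ {x : Grid n ε | cellOf u b x = Q} := hFQ x hx
      rw [Set.indicator_of_mem hxm, Pi.one_apply, mul_one]
      unfold statProb
      rw [← hZ]
      refine div_le_div_of_nonneg_right ?_ hZ0.le
      rw [hk]
      exact_mod_cast R.sq_le_card_moves x
    calc k ^ 2 * (k ^ 2 / Z) ≤ F.card * (k ^ 2 / Z) :=
          mul_le_mul_of_nonneg_right h1 (div_nonneg (sq_nonneg k) hZ0.le)
      _ = F.card • (k ^ 2 / Z) := (nsmul_eq_mul _ _).symm
      _ ≤ ∑ x ∈ F, statProb ρ x * {x | cellOf u b x = Q}.indicator 1 x :=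
          Finset.card_nsmul_le_sum _ _ _ h2
      _ ≤ _ := Finset.sum_le_sum_of_subset_of_nonneg (Finset.subset_univ _) fun x _ _ =>
          mul_nonneg (statProb_nonneg x) (indicator_one_nonneg _ _)
  refine le_trans ?_ (mul_le_mul_of_nonneg_left hmass (Nat.cast_nonneg n))
  rw [← mul_div_assoc, ← mul_div_assoc, div_le_div_iff₀ (by norm_num) hZ0]
  calc (k * ε) ^ 2 * Z ≤ (k * ε) ^ 2 * ((N : ℝ) ^ 2 * (1296 * k ^ 2)) := by gcongr
    _ = 1296 * k ^ 4 * ((N : ℝ) ^ 2 * ε ^ 2) := by ring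
    _ ≤ 1296 * k ^ 4 * (4 * n) := by gcongr
    _ = _ := by ring

/-- In the stationary distribution all cells are densely populated, up to an event of exponentially
small probability. -/
theorem prodExp_not_dense_le (R : Resolution n ρ ε u b) {θ : ℝ}
    (hθ : 4 * θ ≤ ((u : ℝ) * ε) ^ 2 / 5184) :
    prodExp (fun _ : Fin n => statProb (n := n) (ε := ε) ρ)
      ({p | ¬ R.tiling.Dense θ p}.indicator 1) ≤
      (cellCount n ε u b : ℝ) ^ 2 * Real.exp (-(θ * b ^ 2)) := by
  classical
  have hw0 : ∀ (_ : Fin n) (x : Grid n ε), 0 ≤ statProb ρ x := fun _ x => statProb_nonneg x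
  have hw : ∀ _ : Fin n, ∑ x : Grid n ε, statProb ρ x = 1 := fun _ => R.sum_statProb
  set cnt : (Fin n → Grid n ε) → ℕ × ℕ → ℕ := fun p Q =>
    (R.tiling.inCell p Set.univ Q).card with hcnt
  have hcell : ∀ Q ∈ cells (cellCount n ε u b),
      prodExp (fun _ : Fin n => statProb (n := n) (ε := ε) ρ)
        (fun p => Real.exp (θ * b ^ 2) * (1 / 2) ^ cnt p Q) ≤ Real.exp (-(θ * b ^ 2)) := by
    intro Q hQ
    set m := ∑ x : Grid n ε, statProb ρ x * {x | cellOf u b x = Q}.indicator 1 x with hm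
    have hm1 : m ≤ 1 := by
      rw [hm, ← R.sum_statProb]
      exact Finset.sum_le_sum fun x _ =>
        mul_le_of_le_one_right (statProb_nonneg x) (indicator_one_le _ _)
    have h1 := prodExp_mul_half_pow_le hw0 hw (ψ := fun _ => 1) (fun _ => zero_le_one)
      (S := fun _ => {x | cellOf u b x = Q}) (p := m) (by linarith) Finset.univ
      (fun _ _ _ _ => rfl) (fun _ _ _ _ => rfl) (fun _ _ _ _ => le_rfl)
    rw [prodExp_const hw, mul_one, Finset.card_univ, Fintype.card_fin] at h1
    have h2 : prodExp (fun _ : Fin n => statProb (n := n) (ε := ε) ρ)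
        (fun p => (1 / 2) ^ cnt p Q) ≤ Real.exp (-(n * (m / 2))) := by
      refine le_trans (le_of_eq ?_) (h1.trans (one_sub_pow_le_exp (by linarith) n))
      congr 1
      funext p
      rw [one_mul]
      refine congrArg (fun k : ℕ => (1 / 2 : ℝ) ^ k) (congrArg Finset.card ?_)
      ext i
      simp [Tiling.inCell, Resolution.tiling]
    rw [prodExp_const_mul]
    have h3 : 4 * θ * (b : ℝ) ^ 2 ≤ n * m := by
      refine le_trans ?_ (R.le_statProb_cell hQ)
      calc 4 * θ * (b : ℝ) ^ 2 ≤ ((u : ℝ) * ε) ^ 2 / 5184 * (b : ℝ) ^ 2 := by gcongr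
        _ = _ := by push_cast; ring
    calc _ ≤ Real.exp (θ * b ^ 2) * Real.exp (-(n * (m / 2))) := by gcongr
      _ ≤ _ := by
        rw [← Real.exp_add]
        exact Real.exp_le_exp.2 (by linarith)
  calc _ ≤ prodExp (fun _ : Fin n => statProb (n := n) (ε := ε) ρ)
        (fun p => ∑ Q ∈ cells (cellCount n ε u b),
          Real.exp (θ * b ^ 2) * (1 / 2) ^ cnt p Q) := by
        refine prodExp_mono hw0 fun p => ?_
        by_cases hp : R.tiling.Dense θ p
        · rw [Set.indicator_of_notMem (by simpa using hp)]
          positivity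
        · rw [Set.indicator_of_mem hp, Pi.one_apply]
          unfold Tiling.Dense at hp
          push Not at hp
          obtain ⟨Q, hQ, hlt⟩ := hp
          refine le_trans ?_ (Finset.single_le_sum (f := fun Q =>
            Real.exp (θ * b ^ 2) * (1 / 2) ^ cnt p Q) (fun Q _ => by positivity) hQ)
          have h1 : (2 : ℝ) ^ cnt p Q ≤ Real.exp (θ * b ^ 2) :=
            (two_pow_le_exp _).trans (Real.exp_le_exp.2 hlt.le)
          rw [one_div, inv_pow, ← div_eq_mul_inv, one_le_div (by positivity)]
          exact h1
    _ ≤ ∑ Q ∈ cells (cellCount n ε u b), Real.exp (-(θ * b ^ 2)) := by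
        rw [prodExp_sum]
        exact Finset.sum_le_sum hcell
    _ = _ := by
        rw [Finset.sum_const, nsmul_eq_mul]
        simp [cells, sq]

end Resolution

end Geometry

/-! ### From the process to the joint chain -/

section Paths

variable {V X : Type*} [Fintype V]

/-- The state at time `t` along the path `x` of configurations, when only `s` is informed at
time `0`. -/
def pathState (step : Set V → (V → X) → Set V) (s : V) (x : ℕ → V → X) :
    ℕ → (V → X) × Set V
  | 0 => (x 0, {s})
  | t + 1 => (x (t + 1), step (pathState step s x t).2 (x (t + 1)))

/-- The probability of the path `x` up to time `t`. -/
noncomputable def pathWeight (w : X → X → ℝ) (π : X → ℝ) (x : ℕ → V → X) (t : ℕ) : ℝ :=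
  (∏ i, π (x 0 i)) * ∏ k ∈ Finset.range t, ∏ i, w (x k i) (x (k + 1) i)

/-- A finite path, continued by a constant. -/
def extendPath {C : Type*} {t : ℕ} (y : Fin (t + 1) → C) (k : ℕ) : C :=
  if h : k < t + 1 then y ⟨k, h⟩ else y 0

theorem extendPath_snoc {C : Type*} {t : ℕ} (y : Fin (t + 1) → C) (q : C) {k : ℕ} (hk : k ≤ t) :
    extendPath (t := t + 1) (Fin.snoc (α := fun _ => C) y q) k = extendPath y k := by
  unfold extendPath
  rw [dif_pos (by omega), dif_pos (by omega)]
  exact Fin.snoc_castSucc (α := fun _ => C) q y ⟨k, by omega⟩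

theorem extendPath_snoc_last {C : Type*} {t : ℕ} (y : Fin (t + 1) → C) (q : C) :
    extendPath (t := t + 1) (Fin.snoc (α := fun _ => C) y q) (t + 1) = q := by
  unfold extendPath
  rw [dif_pos (by omega)]
  exact Fin.snoc_last (α := fun _ => C) q y

omit [Fintype V] in
theorem pathState_congr (step : Set V → (V → X) → Set V) (s : V) {x x' : ℕ → V → X} (t : ℕ)
    (h : ∀ k ≤ t, x k = x' k) : pathState step s x t = pathState step s x' t := by
  induction t with
  | zero => simp [pathState, h 0 le_rfl]
  | succ t ih =>
    simp only [pathState]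
    rw [ih fun k hk => h k (by omega), h (t + 1) le_rfl]

theorem pathWeight_congr (w : X → X → ℝ) (π : X → ℝ) {x x' : ℕ → V → X} (t : ℕ)
    (h : ∀ k ≤ t, x k = x' k) : pathWeight w π x t = pathWeight w π x' t := by
  unfold pathWeight
  rw [h 0 (Nat.zero_le _)]
  congr 1
  refine Finset.prod_congr rfl fun k hk => ?_
  have := Finset.mem_range.1 hk
  rw [h k (by omega), h (k + 1) (by omega)]

/-- The expectation along the chain as a sum over paths. -/
theorem sum_pathWeight_eq_floodExp [DecidableEq V] [Fintype X] (w : X → X → ℝ)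
    (step : Set V → (V → X) → Set V) (π : X → ℝ) (s : V) (t : ℕ) (f : (V → X) × Set V → ℝ) :
    ∑ y : Fin (t + 1) → V → X,
      pathWeight w π (extendPath y) t * f (pathState step s (extendPath y) t) =
      floodExp w step π s t f := by
  induction t generalizing f with
  | zero =>
    rw [← Equiv.sum_comp (Equiv.funUnique (Fin 1) (V → X)).symm]
    refine Finset.sum_congr rfl fun p _ => ?_
    simp [pathWeight, pathState, extendPath]
  | succ t ih =>
    rw [floodExp_succ, ← ih,
      ← Equiv.sum_comp (Fin.snocEquiv fun _ : Fin (t + 1 + 1) => V → X),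
      Fintype.sum_prod_type, Finset.sum_comm]
    refine Finset.sum_congr rfl fun y _ => ?_
    unfold floodOp prodExp
    rw [Finset.mul_sum]
    refine Finset.sum_congr rfl fun q _ => ?_
    set x : ℕ → V → X :=
      extendPath (t := t + 1) (Fin.snocEquiv (fun _ : Fin (t + 1 + 1) => V → X) (q, y)) with hx
    have hle : ∀ k ≤ t, x k = extendPath y k := fun k hk => extendPath_snoc y q hk
    have hlast : x (t + 1) = q := extendPath_snoc_last y q
    have h1 : pathWeight w π x (t + 1) =
        pathWeight w π (extendPath y) t * ∏ i, w (extendPath y t i) (q i) := by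
      rw [← pathWeight_congr w π t hle, ← hle t le_rfl, ← hlast]
      unfold pathWeight
      rw [Finset.prod_range_succ, mul_assoc]
    have h2 : pathState step s x (t + 1) = (q, step (pathState step s (extendPath y) t).2 q) := by
      rw [← pathState_congr step s t hle]
      simp only [pathState, hlast]
    have h3 : (pathState step s (extendPath y) t).1 = extendPath y t := by
      cases t <;> rfl
    rw [h1, h2, h3]
    ring

end Paths

/-- One time step of flooding in the snapshot graph of the new positions. -/
def floodStep {n : ℕ} {ε : ℝ} (r : ℝ) (I : Set (Fin n)) (q : Fin n → Grid n ε) : Set (Fin n) :=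
  I ∪ {v | ∃ u ∈ I, (snapshot r q).Adj u v}

theorem pathState_floodStep {n : ℕ} {ε : ℝ} (r : ℝ) (s : Fin n) (x : ℕ → Fin n → Grid n ε)
    (t : ℕ) :
    (pathState (floodStep r) s x t).2 = informed (fun t => snapshot r (x t)) s t := by
  induction t with
  | zero => rfl
  | succ t ih =>
    simp only [pathState, informed, floodStep]
    rw [ih]

/-- A union bound over the paths up to time `t`; only subadditivity of `μ` is used. -/
theorem measureReal_informed_ne_univ_le {n : ℕ} {ρ ε r : ℝ} {Ω : Type*} [MeasurableSpace Ω]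
    {μ : Measure Ω} [IsProbabilityMeasure μ] {P : ℕ → Ω → Fin n → Grid n ε}
    (hP : IsStationaryMobility μ n ρ ε P) (s : Fin n) (t : ℕ) :
    μ.real {ω | informed (fun t => snapshot r (P t ω)) s t ≠ Set.univ} ≤
      floodExp (X := Grid n ε) (moveProb ρ) (floodStep r) (statProb ρ) s t uninformed := by
  classical
  rw [← sum_pathWeight_eq_floodExp]
  set bad : Finset (Fin (t + 1) → Fin n → Grid n ε) := Finset.univ.filter fun y =>
    (pathState (floodStep r) s (extendPath y) t).2 ≠ Set.univ with hbad
  have hsub : {ω | informed (fun t => snapshot r (P t ω)) s t ≠ Set.univ} ⊆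
      ⋃ y ∈ bad, {ω | ∀ k ≤ t, P k ω = extendPath y k} := by
    intro ω hω
    have hy : ∀ k ≤ t, P k ω = extendPath (fun j : Fin (t + 1) => P j ω) k := by
      intro k hk
      unfold extendPath
      rw [dif_pos (by omega)]
    refine Set.mem_biUnion (x := fun j : Fin (t + 1) => P j ω) ?_ hy
    rw [Finset.mem_coe, hbad, Finset.mem_filter,
      ← pathState_congr (floodStep r) s (x := fun k => P k ω) t hy, pathState_floodStep]
    exact ⟨Finset.mem_univ _, hω⟩
  have hweight : ∀ y : Fin (t + 1) → Fin n → Grid n ε,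
      μ.real {ω | ∀ k ≤ t, P k ω = extendPath y k} =
        pathWeight (moveProb ρ) (statProb ρ) (extendPath y) t := by
    intro y
    rw [hP.law, Finset.prod_mul_distrib, Finset.prod_comm]
    rfl
  have hpos : ∀ y : Fin (t + 1) → Fin n → Grid n ε,
      0 ≤ pathWeight (moveProb ρ) (statProb ρ) (extendPath y) t := fun y => by
    rw [← hweight]
    exact measureReal_nonneg
  have hu0 : ∀ z : (Fin n → Grid n ε) × Set (Fin n), 0 ≤ uninformed z := fun z =>
    Finset.sum_nonneg fun v _ => indicator_one_nonneg _ _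
  calc _ ≤ μ.real (⋃ y ∈ bad, {ω | ∀ k ≤ t, P k ω = extendPath y k}) :=
      measureReal_mono hsub (measure_ne_top _ _)
    _ ≤ ∑ y ∈ bad, μ.real {ω | ∀ k ≤ t, P k ω = extendPath y k} :=
      measureReal_biUnion_finset_le _ _
    _ ≤ ∑ y ∈ bad, pathWeight (moveProb ρ) (statProb ρ) (extendPath y) t *
        uninformed (pathState (floodStep r) s (extendPath y) t) := by
      refine Finset.sum_le_sum fun y hy => ?_
      rw [hweight]
      refine le_mul_of_one_le_right (hpos y) ?_
      obtain ⟨v, hv⟩ := (Set.ne_univ_iff_exists_notMem _).1 (Finset.mem_filter.1 hy).2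
      refine le_trans ?_ (Finset.single_le_sum (fun v _ => indicator_one_nonneg _ v)
        (Finset.mem_univ v))
      rw [Set.indicator_of_mem hv, Pi.one_apply]
    _ ≤ _ := Finset.sum_le_sum_of_subset_of_nonneg (Finset.subset_univ _) fun y _ _ =>
      mul_nonneg (hpos y) (hu0 _)

theorem transmits_floodStep {n : ℕ} {ε r : ℝ} {u : ℕ} (hε : 0 < ε) (hu : 0 < u)
    (hr : 2 * (u * ε) ≤ r) : Transmits (tileOf (n := n) (ε := ε) u) (floodStep r) where
  subset _ _ := Set.subset_union_left
  mem I q a v ha h := by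
    by_cases hav : a = v
    · exact Or.inl (hav ▸ ha)
    · refine Or.inr ⟨a, ha, hav, (dist_point_le hε (k := u) ?_ ?_).trans hr⟩
      all_goals
        have coord : ∀ c d : ℕ, c / u = d / u → c ≤ d + u ∧ d ≤ c + u := by
          intro c d hcd
          have h1 := Nat.lt_div_mul_add (a := c) hu
          have h2 := Nat.lt_div_mul_add (a := d) hu
          have h3 := Nat.div_mul_le_self c u
          have h4 := Nat.div_mul_le_self d u
          rw [hcd] at h1 h3
          omega
      · exact coord _ _ (congrArg Prod.fst h)
      · exact coord _ _ (congrArg Prod.snd h)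

/-! ### Choice of the constants -/

theorem floodingTime_le {V : Type*} {G : ℕ → SimpleGraph V} {s : V} {t : ℕ}
    (h : informed G s t = Set.univ) : floodingTime G s ≤ t :=
  iInf₂_le t h

theorem one_sub_pow_le_inv_pow {x q C : ℝ} (hx : 1 ≤ x) (hq : q ≤ 1) (hC : 8 ≤ C * q)
    {t : ℕ} (ht : C * Real.log x ≤ t) (hq0 : 0 ≤ q) : (1 - q) ^ t ≤ (x ^ 8)⁻¹ := by
  refine (one_sub_pow_le_exp hq t).trans ?_
  have hx0 : 0 < x := by linarith
  have hlog : 0 ≤ Real.log x := Real.log_nonneg hx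
  rw [show (x ^ 8)⁻¹ = Real.exp (-(8 * Real.log x)) by
    rw [Real.exp_neg, show (8 : ℝ) * Real.log x = (8 : ℕ) * Real.log x by norm_num,
      Real.exp_nat_mul, Real.exp_log hx0]]
  refine Real.exp_le_exp.2 (neg_le_neg ?_)
  nlinarith [mul_le_mul_of_nonneg_right ht hq0, mul_le_mul_of_nonneg_right hC hlog]

/-- If all failure probabilities are at most `x ^ (-8)`, the total failure probability is at most
`x⁻¹`. -/
theorem total_error_le {x t B m d e q₁ q₃ : ℝ} (hx : 2 ≤ x) (ht0 : 0 ≤ t) (ht : t ≤ x)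
    (hB0 : 0 ≤ B) (hB : B ≤ x) (hm0 : 0 ≤ m) (hm : m ≤ x) (hm2 : m ^ 2 ≤ x)
    (hd0 : 0 ≤ d) (hd : d ≤ (x ^ 8)⁻¹) (he0 : 0 ≤ e) (he : e ≤ (x ^ 8)⁻¹)
    (hq₁ : q₁ ≤ (x ^ 8)⁻¹) (hq₃ : q₃ ≤ (x ^ 8)⁻¹) (hq0 : 0 ≤ q₁) :
    q₃ * x + t * (x * (B * (q₁ + t * (d + e)) + (m + t) * (m ^ 2 * d + e))) ≤ x⁻¹ := by
  have hx0 : 0 < x := by linarith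
  set η := (x ^ 8)⁻¹ with hη
  have hη0 : 0 < η := by positivity
  have h1 : q₃ * x + t * (x * (B * (q₁ + t * (d + e)) + (m + t) * (m ^ 2 * d + e))) ≤
      η * x + x * (x * (x * (η + x * (η + η)) + (x + x) * (x * η + η))) := by
    gcongr
  have h2 : η * x ^ 8 = 1 := inv_mul_cancel₀ (by positivity)
  have h3 : η * x + x * (x * (x * (η + x * (η + η)) + (x + x) * (x * η + η))) ≤
      η * (8 * x ^ 4) := by
    have h4 : x + 3 * x ^ 3 ≤ 4 * x ^ 4 := by
      have h5 : 8 ≤ x ^ 3 := by nlinarith [sq_nonneg x, mul_self_nonneg (x - 2)]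
      have h6 : x * 8 ≤ x * x ^ 3 := by gcongr
      have h7 : 2 * x ^ 3 ≤ x * x ^ 3 := by gcongr
      nlinarith
    nlinarith
  refine h1.trans (h3.trans ?_)
  rw [← one_div, le_div_iff₀ hx0]
  have h5 : 8 ≤ x ^ 3 := by
    calc (8 : ℝ) = 2 ^ 3 := by norm_num
      _ ≤ x ^ 3 := by gcongr
  calc η * (8 * x ^ 4) * x = η * x ^ 5 * 8 := by ring
    _ ≤ η * x ^ 5 * x ^ 3 := by gcongr
    _ = 1 := by rw [← h2]; ring

/-- Tile and cell sizes for a transmission radius `r₀` that is large compared with `ε` and a move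
radius `ρ` that is large compared with `r₀`. -/
theorem exists_resolution {n : ℕ} {ρ ε r₀ : ℝ} (hε : 0 < ε) (hr : 6 * ε ≤ r₀) (hρr : 4 * r₀ ≤ ρ)
    (hρ : ρ ≤ √(n : ℝ)) :
    ∃ u b : ℕ, Resolution n ρ ε u b ∧ 2 ≤ b ∧ 2 * (u * ε) ≤ r₀ ∧ r₀ ≤ 6 * (u * ε) ∧
      ρ ≤ 4 * r₀ * b ∧ b * r₀ ≤ ρ := by
  have hr0 : 0 < r₀ := by linarith
  obtain ⟨u, hu⟩ : ∃ u, u = ⌊r₀ / (3 * ε)⌋₊ := ⟨_, rfl⟩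
  have hu1 : (u : ℝ) * (3 * ε) ≤ r₀ := by
    rw [← le_div_iff₀ (by positivity), hu]
    exact Nat.floor_le (by positivity)
  have hu2 : r₀ < (u + 1) * (3 * ε) := by
    rw [← div_lt_iff₀ (by positivity), hu]
    exact Nat.lt_floor_add_one _
  have hu3 : 0 < (u : ℝ) * ε := by linarith
  obtain ⟨b, hb⟩ : ∃ b, b = ⌊ρ / (6 * (u * ε))⌋₊ := ⟨_, rfl⟩
  have hb1 : (b : ℝ) * (6 * (u * ε)) ≤ ρ := by
    rw [← le_div_iff₀ (by positivity), hb]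
    exact Nat.floor_le (div_nonneg (by linarith) (by positivity))
  have hb2 : ρ < (b + 1) * (6 * (u * ε)) := by
    rw [← div_lt_iff₀ (by positivity), hb]
    exact Nat.lt_floor_add_one _
  have hb3 : 2 ≤ b := by
    rw [hb]
    refine Nat.le_floor ?_
    rw [le_div_iff₀ (by positivity)]
    push_cast
    linarith
  have hb0 : (0 : ℝ) ≤ b := Nat.cast_nonneg b
  have hup : 0 < u := by
    rcases Nat.eq_zero_or_pos u with h | h
    · simp [h] at hu3
    · exact h
  refine ⟨u, b, ⟨hε, hup, by omega, ?_, ?_, hρ⟩, hb3, by linarith, by linarith, ?_, ?_⟩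
  · push_cast
    linarith
  · push_cast
    nlinarith
  · nlinarith
  · nlinarith

theorem Resolution.cellCount_le {n : ℕ} {ρ ε : ℝ} {u b : ℕ} (R : Resolution n ρ ε u b) :
    (cellCount n ε u b : ℝ) ≤ 24 * (√(n : ℝ) / ρ) := by
  have hε := R.eps_pos
  have h1 := R.le_rho
  have h2 := R.one_le_mul_eps
  have h3 := R.rho_le_side
  have h4 := R.rho_le
  have hρ : 0 < ρ := by linarith
  have hk : (0 : ℝ) < (b * u : ℕ) := by exact_mod_cast R.mul_pos
  have h5 : (⌊√(n : ℝ) / ε⌋₊ : ℝ) ≤ √(n : ℝ) / ε := Nat.floor_le (by positivity)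
  rw [le_div_iff₀ hε] at h5
  refine Nat.cast_div_le.trans ?_
  rw [div_le_iff₀ hk, mul_assoc, div_mul_eq_mul_div, mul_div_assoc', le_div_iff₀ hρ]
  push_cast at *
  refine le_of_mul_le_mul_right ?_ hε
  have h6 : ((⌊√(n : ℝ) / ε⌋₊ : ℝ) + 1) * ε ≤ 2 * √(n : ℝ) := by linarith
  calc ((⌊√(n : ℝ) / ε⌋₊ : ℝ) + 1) * ρ * ε = ((⌊√(n : ℝ) / ε⌋₊ : ℝ) + 1) * ε * ρ := by ring
    _ ≤ 2 * √(n : ℝ) * (12 * (b * u * ε)) := by gcongr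
    _ = _ := by ring

/-- The bounds on the flooding time and on the failure probability, for explicit constants. Here
`γ = 1 / 1296`; the density `θ = 10 ^ 9` exceeds what the spreading steps need and is guaranteed by
`r₀ ≥ 3 * 10 ^ 7`, and `ρ ≥ 4000 r₀ √(log n)` makes all exponentially small terms negligible. -/
theorem floodExp_uninformed_le_inv {n : ℕ} {ρ ε r r₀ : ℝ} (hn : 2 ≤ n) (hε : 0 < ε)
    (hr₀ : 3 * 10 ^ 7 ≤ r₀) (hr₀ε : 6 * ε ≤ r₀) (hr : r₀ ≤ r) (hρ : ρ ≤ √(n : ℝ))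
    (hc : 4000 * r₀ * √(Real.log n) ≤ ρ) (s : Fin n) :
    ∃ T : ℕ, (T : ℝ) ≤ 10 ^ 9 * (√(n : ℝ) / ρ + Real.log n) ∧
      floodExp (X := Grid n ε) (moveProb ρ) (floodStep r) (statProb ρ) s T uninformed ≤
        (n : ℝ)⁻¹ := by
  have hr0 : 0 < r₀ := by linarith
  set x : ℝ := (n : ℝ) with hx
  have hx2 : 2 ≤ x := by rw [hx]; exact_mod_cast hn
  have hx0 : 0 < x := by linarith
  set l := Real.log x with hl
  have hl2 : 1 / 2 ≤ l := by
    have h1 := Real.log_le_log (by norm_num) hx2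
    have h2 := Real.log_two_gt_d9
    linarith
  have hsl : 1 / 2 ≤ √l := Real.le_sqrt_of_sq_le (by linarith)
  have hρr : 2000 * r₀ ≤ ρ := by nlinarith
  have hρ0 : 0 < ρ := by linarith
  have hρx : ρ ^ 2 ≤ x := by
    have := pow_le_pow_left₀ hρ0.le hρ 2
    rwa [Real.sq_sqrt hx0.le] at this
  have hclx : (4000 * r₀) ^ 2 * l ≤ ρ ^ 2 := by
    have := pow_le_pow_left₀ (by positivity) hc 2
    rwa [mul_pow _ √l, Real.sq_sqrt (by linarith)] at this
  obtain ⟨u, b, R, hb2, hu1, hu2, hb3, hb4⟩ :=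
    exists_resolution (n := n) hε hr₀ε (by linarith) hρ
  have hb0 : (0 : ℝ) ≤ b := Nat.cast_nonneg b
  -- the cells are so large that the exponential bounds are at most `x ^ (-40)`
  have hbl : 40 * l ≤ 1 / 1296 * (b : ℝ) ^ 2 / 8 := by
    have h1 : ρ ^ 2 ≤ (4 * r₀ * b) ^ 2 := pow_le_pow_left₀ hρ0.le hb3 2
    have h2 : 1000000 * l ≤ (b : ℝ) ^ 2 := by
      refine le_of_mul_le_mul_left ?_ (by positivity : 0 < 16 * r₀ ^ 2)
      nlinarith
    linarith
  have hexp40 : Real.exp (-(40 * l)) = (x ^ 40)⁻¹ := by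
    rw [Real.exp_neg, show (40 : ℝ) * l = (40 : ℕ) * l by norm_num, Real.exp_nat_mul,
      Real.exp_log hx0]
  have hexp : Real.exp (-(1 / 1296 * (b : ℝ) ^ 2 / 8)) ≤ (x ^ 40)⁻¹ := by
    rw [← hexp40]
    exact Real.exp_le_exp.2 (by linarith)
  have h40 : x * (x ^ 40)⁻¹ ≤ (x ^ 8)⁻¹ := by
    rw [← div_eq_mul_inv, ← one_div, div_le_div_iff₀ (by positivity) (by positivity)]
    calc x * x ^ 8 = x ^ 9 := by ring
      _ ≤ x ^ 40 := pow_le_pow_right₀ (by linarith) (by norm_num)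
      _ = 1 * x ^ 40 := (one_mul _).symm
  set M := cellCount n ε u b with hM
  have hMle : (M : ℝ) ≤ 24 * (√x / ρ) := R.cellCount_le
  have hsq : √x ^ 2 = x := Real.sq_sqrt hx0.le
  have hMx : (M : ℝ) ≤ √x := by
    refine hMle.trans ?_
    rw [mul_div_assoc', div_le_iff₀ hρ0]
    have := Real.sqrt_nonneg x
    nlinarith
  have hM2 : (M : ℝ) ^ 2 ≤ x := by
    rw [← hsq]
    exact pow_le_pow_left₀ (Nat.cast_nonneg M) hMx 2
  have hM1 : (M : ℝ) ≤ x := by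
    have : 1 ≤ √x := by
      rw [Real.one_le_sqrt]
      linarith
    nlinarith
  have hb2x : (b : ℝ) ^ 2 ≤ x := by
    refine le_trans (pow_le_pow_left₀ hb0 ?_ 2) hρx
    nlinarith
  -- `429981696 = 256 / γ ^ 2`, so that `(1 - γ ^ 2 / 32) ^ t ≤ x ^ (-8)`
  obtain ⟨t, ht⟩ : ∃ t, t = ⌈429981696 * l⌉₊ := ⟨_, rfl⟩
  have ht1 : 429981696 * l ≤ t := ht ▸ Nat.le_ceil _
  have ht2 : (t : ℝ) ≤ 429981698 * l := by
    have : (t : ℝ) < 429981696 * l + 1 := ht ▸ Nat.ceil_lt_add_one (by positivity)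
    linarith
  have htx : (t : ℝ) ≤ x := by
    refine ht2.trans (le_trans ?_ (hclx.trans hρx))
    gcongr
    nlinarith
  have hfx : r₀ ^ 2 ≤ 36 * ((u : ℝ) * ε) ^ 2 := by
    have := pow_le_pow_left₀ hr0.le hu2 2
    rwa [mul_pow, show (6 : ℝ) ^ 2 = 36 by norm_num] at this
  refine ⟨t + M + t, ?_, ?_⟩
  · push_cast
    have : 0 ≤ √x / ρ := by positivity
    linarith
  · have hd0 : 0 ≤ 2 * Real.exp (-(1 / 1296 * (b : ℝ) ^ 2 / 8)) := by positivity
    have hdx : 2 * Real.exp (-(1 / 1296 * (b : ℝ) ^ 2 / 8)) ≤ (x ^ 8)⁻¹ := by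
      refine le_trans ?_ h40
      gcongr
    have hr₀2 : (3 * 10 ^ 7) ^ 2 ≤ r₀ ^ 2 := pow_le_pow_left₀ (by norm_num) hr₀ 2
    have hθ : 4 * ((10 : ℝ) ^ 9 + 1) ≤ ((u : ℝ) * ε) ^ 2 / 5184 := by
      rw [le_div_iff₀ (by norm_num)]
      linarith
    have he := R.prodExp_not_dense_le hθ
    have hex : (M : ℝ) ^ 2 * Real.exp (-((10 ^ 9 + 1) * (b : ℝ) ^ 2)) ≤ (x ^ 8)⁻¹ := by
      refine le_trans ?_ h40
      refine mul_le_mul hM2 (le_trans (Real.exp_le_exp.2 ?_) hexp) (Real.exp_pos _).le hx0.le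
      have hB := sq_nonneg (b : ℝ)
      linarith only [hB]
    -- the threshold `K = 82944` of the potential is `64 / γ`
    have main := R.tiling.floodExp_uninformed_le (step := floodStep r)
      (transmits_floodStep hε R.u_pos (hu1.trans hr)) moveProb_nonneg R.sum_moveProb
      (by norm_num) (by norm_num) hb2 ?_ (θ := 10 ^ 9) (by norm_num) (K := 82944) (by norm_num)
      (by norm_num) statProb_nonneg R.sum_statProb R.sum_statProb_mul_moveProb s le_rfl he t t
    · refine main.trans ?_
      rw [Fintype.card_fin]
      refine total_error_le hx2 (Nat.cast_nonneg t) htx (by positivity) hb2x (Nat.cast_nonneg M)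
        hM1 hM2 hd0 hdx (by positivity) hex ?_ ?_ ?_
      · exact one_sub_pow_le_inv_pow (C := 429981696) (by linarith) (by norm_num) (by norm_num)
          ht1 (by norm_num)
      · exact one_sub_pow_le_inv_pow (C := 429981696) (by linarith) (by norm_num) (by norm_num)
          ht1 (by norm_num)
      · norm_num
    · refine hexp.trans ?_
      calc (x ^ 40)⁻¹ ≤ ((2 : ℝ) ^ 40)⁻¹ := by gcongr
        _ ≤ _ := by norm_num

end GeoMEG

theorem theorem1 (ε₀ : ℝ) (hε₀ : 0 < ε₀) :
    ∃ r₀ c C a : ℝ, 0 < r₀ ∧ 0 < c ∧ 0 < C ∧ 0 < a ∧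
      ∀ (n : ℕ) (ρ r ε : ℝ), 0 < ε → ε ≤ ε₀ → 0 < ρ → ρ ≤ √(n : ℝ) →
        r₀ ≤ r → c * √(Real.log n) ≤ ρ →
        ∀ (Ω : Type*) [MeasurableSpace Ω] (μ : Measure Ω) [IsProbabilityMeasure μ]
          (P : ℕ → Ω → Fin n → GeoMEG.Grid n ε), GeoMEG.IsStationaryMobility μ n ρ ε P →
        ∀ s : Fin n,
          1 - (n : ℝ) ^ (-a) ≤
            μ.real {ω |
              (GeoMEG.floodingTime (fun t => GeoMEG.snapshot r (P t ω)) s : ℝ≥0∞) ≤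
                ENNReal.ofReal (C * (√(n : ℝ) / ρ + Real.log n))} := by
  refine ⟨3 * 10 ^ 7 + 6 * ε₀, 4000 * (3 * 10 ^ 7 + 6 * ε₀), 10 ^ 9, 1, by positivity,
    by positivity, by norm_num, one_pos, ?_⟩
  intro n ρ r ε hε hεε₀ _ hρ hr hc Ω _ μ _ P hP s
  rw [Real.rpow_neg_one]
  rcases Nat.lt_or_ge n 2 with hn | hn
  · -- for a single node the claimed lower bound on the probability is zero
    have h1 : n = 1 := by
      have := s.pos
      omega
    subst h1
    simp
  obtain ⟨T, hT, hle⟩ := GeoMEG.floodExp_uninformed_le_inv hn hε (by linarith) (by linarith) hr hρ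
    hc s
  have hbad := (GeoMEG.measureReal_informed_ne_univ_le (r := r) hP s T).trans hle
  have hcover : (Set.univ : Set Ω) ⊆
      {ω | (GeoMEG.floodingTime (fun t => GeoMEG.snapshot r (P t ω)) s : ℝ≥0∞) ≤
        ENNReal.ofReal (10 ^ 9 * (√(n : ℝ) / ρ + Real.log n))} ∪
      {ω | GeoMEG.informed (fun t => GeoMEG.snapshot r (P t ω)) s T ≠ Set.univ} := by
    intro ω _
    by_cases h : GeoMEG.informed (fun t => GeoMEG.snapshot r (P t ω)) s T = Set.univ
    · left
      have h1 : (GeoMEG.floodingTime (fun t => GeoMEG.snapshot r (P t ω)) s : ℝ≥0∞) ≤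
          ((T : ℕ∞) : ℝ≥0∞) := ENat.toENNReal_le.2 (GeoMEG.floodingTime_le h)
      refine h1.trans ?_
      rw [ENat.toENNReal_coe, ← ENNReal.ofReal_natCast]
      exact ENNReal.ofReal_le_ofReal hT
    · exact Or.inr h
  have h1 := measureReal_mono (μ := μ) hcover (measure_ne_top _ _)
  rw [probReal_univ] at h1
  have h2 := h1.trans (measureReal_union_le _ _)
  linarith
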